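/- Let $n\ge 2$, let $J\colon\mathbb{R}^n\to\mathbb{R}$ be smooth, and let $a,b,h>0$. Let $\mathbb{B}$ be the closed Euclidean unit ball of $\mathbb{R}^n$ and put $$\bar J_a(x):=\frac{1}{\mathrm{vol}(\mathbb{B})}\int_{\mathbb{B}}J(x+a\,\xi)\,\mathrm{d}\xi .$$ Let $\phi\colon\mathbb{R}^{n-1}\to\partial\mathbb{B}$ be the spherical coordinates whose first two components are $\cos\vartheta_0\prod_{l=1}^{n-2}\sin\vartheta_l$ and $\sin\vartheta_0\prod_{l=1}^{n-2}\sin\vartheta_l$, and whose $(i+2)$-th component is $\cos\vartheta_i\prod_{l=i+1}^{n-2}\sin\vartheta_l$ for $i=1,\dots,n-2$; let $g(\vartheta):=\big|\prod_{l=1}^{n-2}\sin^l(\vartheta_l)\big|$ (the square root of the Gram determinant of $\phi$). For every positive integer $k$ put $\theta_k(\tau):=(\tau,2^{k-1}\tau,2^{2k-1}\tau,\dots,2^{(n-2)k-1}\tau)$, $U_k:=\phi\circ\theta_k$, and $v_k:=(g\circ\theta_k)\,U_k$. For $\omega>0$ and a disturbance $d\in L_\infty(\mathbb{R};\mathbb{R})$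 with essential supremum norm $\|d\|$, consider the system $$\dot{\tilde x}(t)=\big(J(\tilde x(t)+a\,U_k(\omega t))-\eta(t)+d(t)\big)\,b\,v_k(\omega t),\qquad \dot\eta(t)=-h\,\eta(t)+h\,J(\tilde x(t)+a\,U_k(\omega t))+h\,d(t)\tag{$*$}$$ in $\mathbb{R}^n\times\mathbb{R}$ (solutions in the sense of Carathéodory). Recall that a function $\gamma\colon[0,\infty)\to[0,\infty)$ is of class $\mathcal{K}$ if it is continuous, strictly increasing, and $\gamma(0)=0$, and that a continuous function $\beta\colon[0,\infty)^2\to[0,\infty)$ is of class $\mathcal{KL}$ if $\beta(\cdot,t)$ is of class $\mathcal{K}$ for every $t\ge0$ and $\beta(s,\cdot)$ is non-increasing with limit $0$ at infinity for every $s\ge0$. **Theorem 1.** Let $y_*>y_0$ be real numbers such that the superlevel set $\tilde K_0:=\{x\in\mathbb{R}^n: \bar J_a(x)\ge y_0\}$ is compact and such that $\nabla\bar J_a(x)\ne0$ for every $x\in\mathbb{R}^n$ with $y_*>\bar J_a(x)\ge y_0$. Let $\rho_0>0$. Then there exist a function $\beta$ of class $\mathcal{KL}$ with $\beta(s,0)=s$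 for every $s\ge0$, a function $\gamma$ of class $\mathcal{K}$, and constants $\delta,\rho>0$ with the following property. For every $\varepsilon>0$ there exist a real number $\omega_0>0$ and an integer $k_0>0$ such that, for every real $\omega\ge\omega_0$, every integer $k\ge k_0$, every $t_0\in\mathbb{R}$, every $\tilde x_0\in\tilde K_0$, every $\eta_0\in\mathbb{R}$ with $|\eta_0|\le\rho_0$, and every $d\in L_\infty(\mathbb{R};\mathbb{R})$ with $\|d\|\le\delta$, the maximal solution $(\tilde x,\eta)$ of $(*)$ with $\tilde x(t_0)=\tilde x_0$, $\eta(t_0)=\eta_0$ exists for all $t\ge t_0$ and satisfies $$y_*-\bar J_a(\tilde x(t))\ \le\ \max\big\{\beta\big(\max\{y_*-\bar J_a(\tilde x_0),0\},\,t-t_0\big),\ \gamma(\|d\|)\big\}+\varepsilon$$ and $|\eta(t)|\le\rho$ for every $t\ge t_0$. -/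

import Mathlib

open MeasureTheory Set Filter Topology

noncomputable section

namespace ExtremumSeeking

/-- The state space `ℝⁿ` with its Euclidean norm, where `n = m + 2`; thus `m : ℕ` ranges over all
dimensions `n ≥ 2`. -/
abbrev State (m : ℕ) : Type := EuclideanSpace ℝ (Fin (m + 2))

/-- Spherical coordinates `φ : ℝⁿ⁻¹ → ℝⁿ` with angles `ϑ_0, …, ϑ_{n-2}`. The first component is
`cos ϑ_0 * sin ϑ_1 * ⋯ * sin ϑ_{n-2}`, the second one is
`sin ϑ_0 * sin ϑ_1 * ⋯ * sin ϑ_{n-2}`, and the component with (zero-based) index `i + 1`, `i ≥ 1`,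
is `cos ϑ_i * sin ϑ_{i+1} * ⋯ * sin ϑ_{n-2}`. -/
def sphCoord (m : ℕ) (ϑ : Fin (m + 1) → ℝ) : State m :=
  WithLp.toLp 2 (Fin.cons (α := fun _ => ℝ)
    (Real.cos (ϑ 0) * ∏ l ∈ Finset.Ioi (0 : Fin (m + 1)), Real.sin (ϑ l))
    (fun i : Fin (m + 1) =>
      (if i = 0 then Real.sin (ϑ i) else Real.cos (ϑ i)) *
        ∏ l ∈ Finset.Ioi i, Real.sin (ϑ l)))

/-- The square root of the Gram determinant of the spherical coordinates,
`g(ϑ) = |sin ϑ_1 * sin² ϑ_2 * ⋯ * sin^{n-2} ϑ_{n-2}|`. -/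
def gramWeight (m : ℕ) (ϑ : Fin (m + 1) → ℝ) : ℝ :=
  |∏ l : Fin (m + 1), Real.sin (ϑ l) ^ (l : ℕ)|

/-- The angle curve `θ_k(τ) = (τ, 2^{k-1} τ, 2^{2k-1} τ, …, 2^{(n-2)k-1} τ)`. -/
def angleCurve (m k : ℕ) (τ : ℝ) : Fin (m + 1) → ℝ :=
  fun i => if i = 0 then τ else (2 : ℝ) ^ ((i : ℕ) * k) / 2 * τ

/-- The curve `U_k = φ ∘ θ_k` on the unit sphere. -/
def curveU (m k : ℕ) (τ : ℝ) : State m := sphCoord m (angleCurve m k τ)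

/-- The dither signal `v_k = (g ∘ θ_k) U_k`. -/
def ditherV (m k : ℕ) (τ : ℝ) : State m := gramWeight m (angleCurve m k τ) • curveU m k τ

/-- The averaged objective function: the mean value of `J` over the closed ball of radius `a`
centered at `x`, written as an integral over the closed unit ball. -/
def avgObj {m : ℕ} (J : State m → ℝ) (a : ℝ) (x : State m) : ℝ :=
  (volume.real (Metric.closedBall (0 : State m) 1))⁻¹ *
    ∫ ξ in Metric.closedBall (0 : State m) 1, J (x + a • ξ)

/-- Comparison functions of class `K` (only the values on `[0, ∞)` matter). -/
structure ClassK (γ : ℝ → ℝ) : Prop where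
  continuousOn : ContinuousOn γ (Ici 0)
  strictMonoOn : StrictMonoOn γ (Ici 0)
  map_zero : γ 0 = 0

/-- Comparison functions of class `KL` (only the values on `[0, ∞) × [0, ∞)` matter). -/
structure ClassKL (β : ℝ → ℝ → ℝ) : Prop where
  continuousOn : ContinuousOn (Function.uncurry β) (Ici 0 ×ˢ Ici 0)
  classK : ∀ t, 0 ≤ t → ClassK (fun s => β s t)
  antitoneOn : ∀ s, 0 ≤ s → AntitoneOn (β s) (Ici 0)
  tendsto_zero : ∀ s, 0 ≤ s → Tendsto (β s) atTop (𝓝 0)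

/-- Right-hand side of the `x`-subsystem of the transformed closed-loop system. The real number
`dt` is the value of the disturbance at time `t`. -/
def rhsX {m : ℕ} (J : State m → ℝ) (a b ω : ℝ) (k : ℕ) (dt t : ℝ) (x : State m) (η : ℝ) :
    State m :=
  J (x + a • curveU m k (ω * t)) • b • ditherV m k (ω * t)
    - η • b • ditherV m k (ω * t) + dt • b • ditherV m k (ω * t)

/-- Right-hand side of the filter equation of the transformed closed-loop system. -/
def rhsEta {m : ℕ} (J : State m → ℝ) (a h ω : ℝ) (k : ℕ) (dt t : ℝ) (x : State m) (η : ℝ) : ℝ :=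
  -h * η + h * J (x + a • curveU m k (ω * t)) + h * dt

/-- `(x, η)` is a (Carathéodory) solution on the interval `I ∋ t₀` of the transformed closed-loop
system with disturbance `d` and initial condition `x(t₀) = x₀`, `η(t₀) = η₀`. The disturbance is
merely measurable and essentially bounded, so the differential equation is understood in its
integrated form. The values of `x` and `η` outside of `I` are irrelevant. -/
structure IsSolution {m : ℕ} (J : State m → ℝ) (a b h ω : ℝ) (k : ℕ) (d : ℝ → ℝ)
    (t₀ : ℝ) (x₀ : State m) (η₀ : ℝ) (I : Set ℝ) (x : ℝ → State m) (η : ℝ → ℝ) : Prop where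
  mem : t₀ ∈ I
  ordConnected : I.OrdConnected
  continuousOn_x : ContinuousOn x I
  continuousOn_eta : ContinuousOn η I
  integrable_x : ∀ t ∈ I,
    IntervalIntegrable (fun s => rhsX J a b ω k (d s) s (x s) (η s)) volume t₀ t
  integrable_eta : ∀ t ∈ I,
    IntervalIntegrable (fun s => rhsEta J a h ω k (d s) s (x s) (η s)) volume t₀ t
  eq_x : ∀ t ∈ I, x t = x₀ + ∫ s in t₀..t, rhsX J a b ω k (d s) s (x s) (η s)
  eq_eta : ∀ t ∈ I, η t = η₀ + ∫ s in t₀..t, rhsEta J a h ω k (d s) s (x s) (η s)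

/-- A maximal solution: a solution that cannot be extended to a strictly larger interval. -/
structure IsMaximalSolution {m : ℕ} (J : State m → ℝ) (a b h ω : ℝ) (k : ℕ) (d : ℝ → ℝ)
    (t₀ : ℝ) (x₀ : State m) (η₀ : ℝ) (I : Set ℝ) (x : ℝ → State m) (η : ℝ → ℝ) : Prop where
  isSolution : IsSolution J a b h ω k d t₀ x₀ η₀ I x η
  maximal : ∀ (I' : Set ℝ) (x' : ℝ → State m) (η' : ℝ → ℝ),
    IsSolution J a b h ω k d t₀ x₀ η₀ I' x' η' → I ⊆ I' → EqOn x' x I → EqOn η' η I → I' = I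

end ExtremumSeeking

end

/-! Write W for the averaged objective and T = 2π/ω for the dither period. During one period x and η
move only by O(T), so x changes by approximately bT times the mean of (J(x + aU) - η)v with x and η
frozen, plus the effect of d. Three facts identify this mean.

(1) The angles run with frequencies 1, 2^(k-1), 2^(2k-1), ..., so the mean over the curve is within
O(2^(-k)) of the mean over the torus of angles (`abs_curve_average_sub_torus_average_le`, by
induction, averaging out the fastest angle). (2) With weight g, the torus mean is a surface integral
over the sphere, covered 2^m times (`lintegral_polarIntegrand`). (3) The integral of J times the
normal over a sphere is the derivative of the ball integral under translation. This divergence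
theorem is obtained by differentiating the radial limit of a shifted ball in spherical coordinates
(`hasDerivAt_integral_closedBall`). Subtracting a constant from J does not change ∇W, so the frozen
η drops out.

Hence W gains over each period at least T(bc|∇W|² - b‖d‖|∇W| - e), where c > 0 is a fixed gain and e
= O(2^(-k)) + O(T) (`exists_period_increase`).

By compactness |∇W| ≥ α(y⋆ - W) on the part of the superlevel set where W ≤ y⋆, for an increasing
homeomorphism α of ℝ fixing 0 (`exists_orderIso_le`). While u = y⋆ - W is at least γ(‖d‖) =
α⁻¹(2‖d‖/c) and a small ε₁, half of bc|∇W|² absorbs the disturbance and a quarter of bcα(u)² absorbs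
e. So u decreases at rate λ(u) = (bc/4)α(u)². The bound β(s,t) is the root u of u + tλ(u) = s
instead of a flow: then β(s,0) = s and the class KL properties are elementary, and the sampled
values obey this bound up to one period (`practical_iss_of_sampled_decrease`).

To have global bounds, J is first replaced by a compactly supported f. For f, Picard-Lindelöf gives
solutions on every interval, and |η| ≤ ρ because the filter input is bounded. The estimate keeps x
near the superlevel set, where f = J, so the solution also solves the original system; by uniqueness
every maximal solution extends it. -/

noncomputable section

/-! ### Comparison functions and a discrete decrease principle -/

namespace ExtremumSeeking

/-- A continuous quantity `G ≥ 0` on a compact set that is positive wherever `Y` is positive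
dominates a strictly increasing function of `Y`. -/
theorem exists_orderIso_le {X : Type*} [TopologicalSpace X] {K : Set X} (hK : IsCompact K)
    {Y G : X → ℝ} (hY : ContinuousOn Y K) (hG : ContinuousOn G K) (hG0 : ∀ x ∈ K, 0 ≤ G x)
    (hpos : ∀ x ∈ K, 0 < Y x → 0 < G x) :
    ∃ α : ℝ ≃o ℝ, α 0 = 0 ∧ ∀ x ∈ K, 0 ≤ Y x → α (Y x) ≤ G x := by
  rcases K.eq_empty_or_nonempty with rfl | hne
  · exact ⟨OrderIso.refl ℝ, rfl, by simp⟩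
  obtain ⟨S, hS⟩ := hK.bddAbove_image hY
  replace hS : ∀ x ∈ K, Y x ≤ S := fun x hx => hS ⟨x, hx, rfl⟩
  have : Nonempty K := hne.to_subtype
  -- The infimum `q` of this penalised function over `K` is monotone and 1-Lipschitz in `s`, and the
  -- penalty vanishes at `s = Y x`, so `q (Y x) ≤ G x`. It is positive for `s > 0`: at a minimiser
  -- either `Y x > 0`, hence `G x > 0`, or the penalty is positive.
  let H : ℝ → K → ℝ := fun s x => G x + max (s - Y x) 0
  have hH0 : ∀ s x, 0 ≤ H s x := fun s x => add_nonneg (hG0 x x.2) (le_max_right _ _)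
  have hbdd : ∀ s, BddBelow (range (H s)) := fun s => ⟨0, by rintro _ ⟨x, rfl⟩; exact hH0 s x⟩
  let q : ℝ → ℝ := fun s => ⨅ x, H s x
  have hq0 : ∀ s, 0 ≤ q s := fun s => le_ciInf (hH0 s)
  have hqle : ∀ s x, q s ≤ H s x := fun s x => ciInf_le (hbdd s) x
  have hqmono : Monotone q := fun s t hst => ciInf_mono (hbdd s) fun x => by
    simp only [H]; gcongr
  have hqlip : ∀ s t, s ≤ t → q t ≤ q s + (t - s) := fun s t hst => by
    rw [← sub_le_iff_le_add]
    refine le_ciInf fun x => ?_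
    have h1 := hqle t x
    have h2 : max (t - Y x) 0 ≤ max (s - Y x) 0 + (t - s) := by
      apply max_le
      · linarith [le_max_left (s - Y x) 0]
      · linarith [le_max_right (s - Y x) 0]
    simp only [H] at h1 ⊢
    linarith
  have hqcont : Continuous q := by
    refine LipschitzWith.continuous (K := 1) (LipschitzWith.of_le_add fun s t => ?_)
    rw [Real.dist_eq]
    rcases le_total s t with h | h
    · linarith [hqmono h, abs_nonneg (s - t)]
    · rw [abs_of_nonneg (sub_nonneg.2 h)]; exact hqlip t s h
  have hqpos : ∀ s, 0 < s → 0 < q s := fun s hs => by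
    have hc : ContinuousOn (fun x => G x + max (s - Y x) 0) K := by fun_prop
    obtain ⟨x, hx, hmin⟩ := hK.exists_isMinOn hne hc
    refine lt_of_lt_of_le ?_ (le_ciInf fun y : K => hmin y.2)
    simp only
    by_cases h : 0 < Y x
    · exact add_pos_of_pos_of_nonneg (hpos x hx h) (le_max_right _ _)
    · exact add_pos_of_nonneg_of_pos (hG0 x hx) (lt_max_of_lt_left (by linarith))
  -- The factor s/(1+s) < 1 turns the monotone `q` into a strictly increasing function without
  -- exceeding it. The outer terms make `f` unbounded in both directions and vanish on [0, max S 0],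
  -- which contains all nonnegative values of `Y`.
  let f : ℝ → ℝ := fun s => min s 0 + max s 0 / (1 + max s 0) * q s + max (s - max S 0) 0
  have hden : ∀ s : ℝ, 1 + max s 0 ≠ 0 := fun s => by
    have := le_max_right s 0; positivity
  have hfcont : Continuous f := by
    have : Continuous fun s : ℝ => max s 0 / (1 + max s 0) :=
      Continuous.div (by fun_prop) (by fun_prop) hden
    fun_prop
  have hfrac : ∀ s t : ℝ, 0 ≤ s → s < t → s / (1 + s) < t / (1 + t) := fun s t hs hst => by
    rw [div_lt_div_iff₀ (by linarith) (by linarith)]; nlinarith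
  have hfmono : StrictMono f := by
    intro s t hst
    have h3 : max (s - max S 0) 0 ≤ max (t - max S 0) 0 := by gcongr
    rcases lt_or_ge s 0 with hs | hs
    · have h1 : min s 0 < min t 0 := by
        rw [min_eq_left hs.le]; exact lt_min hst hs
      have h2 : 0 ≤ max t 0 / (1 + max t 0) * q t := by
        have := hq0 t; positivity
      simp only [f, max_eq_right hs.le, zero_div, zero_mul]
      linarith
    · have ht : 0 < t := hs.trans_lt hst
      have h2 : s / (1 + s) * q s < t / (1 + t) * q t :=
        calc s / (1 + s) * q s ≤ s / (1 + s) * q t := by gcongr; exact hqmono hst.le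
          _ < t / (1 + t) * q t := mul_lt_mul_of_pos_right (hfrac s t hs hst) (hqpos t ht)
      simp only [f, max_eq_left hs, max_eq_left ht.le, min_eq_right hs, min_eq_right ht.le]
      linarith
  have htop : Tendsto f atTop atTop := by
    refine tendsto_atTop_mono' atTop ?_ (tendsto_atTop_add_const_right atTop (-max S 0) tendsto_id)
    filter_upwards [eventually_ge_atTop 0] with s hs
    have := hq0 s
    simp only [f, max_eq_left hs, min_eq_right hs, id]
    have h2 : 0 ≤ s / (1 + s) * q s := by positivity
    linarith [le_max_left (s - max S 0) 0]
  have hbot : Tendsto f atBot atBot := by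
    refine tendsto_atBot_mono' atBot ?_ tendsto_id
    filter_upwards [eventually_le_atBot 0] with s hs
    have : s - max S 0 ≤ 0 := by linarith [le_max_right S 0]
    simp [f, max_eq_right hs, max_eq_right this]
  refine ⟨hfmono.orderIsoOfSurjective f (hfcont.surjective htop hbot), ?_, fun x hx hYx => ?_⟩
  · simp [f]
  · have h1 : Y x - max S 0 ≤ 0 := by linarith [le_max_left S 0, hS x hx]
    have h2 := hqle (Y x) ⟨x, hx⟩
    simp only [H, sub_self, max_self, add_zero] at h2
    have h3 : Y x / (1 + Y x) ≤ 1 := by rw [div_le_one (by linarith)]; linarith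
    have h4 : Y x / (1 + Y x) * q (Y x) ≤ 1 * q (Y x) := by
      gcongr; exact hq0 _
    simp only [StrictMono.coe_orderIsoOfSurjective, f, max_eq_left hYx, min_eq_right hYx,
      max_eq_right h1]
    linarith

/-- The implicit Euler step `u + t * lam u = s` defines a class `KL` function of `(s, t)`. -/
theorem exists_classKL_implicit {lam : ℝ → ℝ} (hc : Continuous lam) (hm : StrictMono lam)
    (h0 : lam 0 = 0) :
    ∃ β : ℝ → ℝ → ℝ, ClassKL β ∧ (∀ s, 0 ≤ s → β s 0 = s) ∧
      ∀ s t, 0 ≤ s → 0 ≤ t → 0 ≤ β s t ∧ β s t + t * lam (β s t) = s := by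
  have hex : ∀ s t : ℝ, ∃ u, 0 ≤ s → 0 ≤ t → 0 ≤ u ∧ u + t * lam u = s := by
    intro s t
    by_cases h : 0 ≤ s ∧ 0 ≤ t
    · obtain ⟨hs, ht⟩ := h
      have hcont : ContinuousOn (fun u => u + t * lam u) (Icc 0 s) := by fun_prop
      have hls : 0 ≤ lam s := h0 ▸ hm.monotone hs
      obtain ⟨u, hu, hu'⟩ := intermediate_value_Icc hs hcont
        (show s ∈ Icc (0 + t * lam 0) (s + t * lam s) from
          ⟨by simpa [h0] using hs, by nlinarith⟩)
      exact ⟨u, fun _ _ => ⟨hu.1, hu'⟩⟩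
    · exact ⟨0, fun hs ht => absurd ⟨hs, ht⟩ h⟩
  choose β hβ using hex
  have hlam : ∀ u, 0 ≤ u → 0 ≤ lam u := fun u hu => h0 ▸ hm.monotone hu
  have hle : ∀ s t, 0 ≤ s → 0 ≤ t → β s t ≤ s := fun s t hs ht => by
    obtain ⟨h1, h2⟩ := hβ s t hs ht
    nlinarith [hlam _ h1]
  have huniq : ∀ t u u' : ℝ, 0 ≤ t → u + t * lam u < u' + t * lam u' → u < u' := by
    intro t u u' ht h
    by_contra hcon
    have := hm.monotone (not_lt.1 hcon)
    nlinarith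
  -- Subtracting the two defining equations bounds the increment of `β`; used in both directions,
  -- this gives joint continuity.
  have hkey : ∀ s t s' t', 0 ≤ s → 0 ≤ t → 0 ≤ s' → 0 ≤ t' →
      β s t - β s' t' ≤ |s - s'| + |t - t'| * lam s' := by
    intro s t s' t' hs ht hs' ht'
    obtain ⟨h1, h2⟩ := hβ s t hs ht
    obtain ⟨h1', h2'⟩ := hβ s' t' hs' ht'
    have hl : lam (β s' t') ≤ lam s' := hm.monotone (hle s' t' hs' ht')
    have hR : 0 ≤ |s - s'| + |t - t'| * lam s' :=
      add_nonneg (abs_nonneg _) (mul_nonneg (abs_nonneg _) (hlam _ hs'))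
    rcases le_total (β s t) (β s' t') with h | h
    · linarith
    · have h3 : t * lam (β s' t') ≤ t * lam (β s t) := by gcongr; exact hm.monotone h
      have h4 : (t' - t) * lam (β s' t') ≤ |t - t'| * lam s' := by
        rw [abs_sub_comm]
        exact mul_le_mul (le_abs_self _) hl (hlam _ h1') (abs_nonneg _)
      have h5 := le_abs_self (s - s')
      nlinarith
  refine ⟨β, ⟨?_, ?_, ?_, ?_⟩, ?_, hβ⟩
  · rintro ⟨s', t'⟩ ⟨hs', ht'⟩
    simp only [mem_Ici] at hs' ht'
    rw [ContinuousWithinAt, tendsto_iff_dist_tendsto_zero]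
    have hlim : Tendsto (fun p : ℝ × ℝ => |p.1 - s'| + |p.2 - t'| * (lam s' + lam p.1))
        (𝓝[Ici 0 ×ˢ Ici 0] (s', t')) (𝓝 0) := by
      have : Continuous fun p : ℝ × ℝ => |p.1 - s'| + |p.2 - t'| * (lam s' + lam p.1) := by
        fun_prop
      have h := (this.tendsto (s', t')).mono_left
        (nhdsWithin_le_nhds (s := Ici (0 : ℝ) ×ˢ Ici (0 : ℝ)))
      simpa using h
    refine squeeze_zero' (Eventually.of_forall fun _ => dist_nonneg) ?_ hlim
    filter_upwards [self_mem_nhdsWithin] with p hp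
    obtain ⟨hp1, hp2⟩ := hp
    simp only [mem_Ici] at hp1 hp2
    have h1 := hkey p.1 p.2 s' t' hp1 hp2 hs' ht'
    have h2 := hkey s' t' p.1 p.2 hs' ht' hp1 hp2
    rw [abs_sub_comm s', abs_sub_comm t'] at h2
    have h3 : 0 ≤ |p.2 - t'| * lam s' := mul_nonneg (abs_nonneg _) (hlam _ hs')
    have h4 : 0 ≤ |p.2 - t'| * lam p.1 := mul_nonneg (abs_nonneg _) (hlam _ hp1)
    simp only [Function.uncurry, Real.dist_eq]
    rw [abs_le]
    constructor <;> nlinarith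
  · intro t ht
    refine ⟨?_, ?_, ?_⟩
    · intro s' hs'
      simp only [mem_Ici] at hs'
      rw [ContinuousWithinAt, tendsto_iff_dist_tendsto_zero]
      have hlim : Tendsto (fun s : ℝ => |s - s'|) (𝓝[Ici 0] s') (𝓝 0) := by
        have : Continuous fun s : ℝ => |s - s'| := by fun_prop
        simpa using (this.tendsto s').mono_left nhdsWithin_le_nhds
      refine squeeze_zero' (Eventually.of_forall fun _ => dist_nonneg) ?_ hlim
      filter_upwards [self_mem_nhdsWithin] with s hs
      have h1 := hkey s t s' t hs ht hs' ht
      have h2 := hkey s' t s t hs' ht hs ht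
      rw [abs_sub_comm s'] at h2
      simp only [sub_self, abs_zero, zero_mul, add_zero] at h1 h2
      rw [Real.dist_eq, abs_le]
      constructor <;> linarith
    · intro s hs s' hs' hss
      refine huniq t _ _ ht ?_
      rw [(hβ s t hs ht).2, (hβ s' t hs' ht).2]; exact hss
    · exact le_antisymm (hle 0 t le_rfl ht) (hβ 0 t le_rfl ht).1
  · intro s hs t ht t' ht' htt
    by_contra hcon
    obtain ⟨h1, h2⟩ := hβ s t hs ht
    obtain ⟨h1', h2'⟩ := hβ s t' hs ht'
    have := hm (not_le.1 hcon)
    have := hlam _ h1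
    simp only [mem_Ici] at ht ht'
    nlinarith
  · intro s hs
    rw [Metric.tendsto_atTop]
    intro ε hε
    have hle' : 0 < lam ε := h0 ▸ hm hε
    -- For such `t` the value ε already gives ε + tλ(ε) > s, so the root lies below ε.
    refine ⟨max 0 (s / lam ε), fun t ht => ?_⟩
    have ht0 : 0 ≤ t := le_trans (le_max_left _ _) ht
    obtain ⟨h1, h2⟩ := hβ s t hs ht0
    rw [Real.dist_eq, sub_zero, abs_of_nonneg h1]
    refine huniq t _ _ ht0 ?_
    rw [h2]
    have := (div_le_iff₀ hle').1 (le_trans (le_max_right _ _) ht)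
    linarith
  · intro s hs
    have := (hβ s 0 hs le_rfl).2
    simpa using this

/-- Discrete decrease: if a sequence decreases at rate `lam` above the level `G` and never rises by
more than `c`, then it is below `G + c` or has decreased as prescribed by the implicit step. -/
theorem le_or_implicit_of_decrease {lam : ℝ → ℝ} (hm : Monotone lam) {y : ℕ → ℝ} {G c T s : ℝ}
    (hT : 0 ≤ T) {N : ℕ} (hs : y 0 ≤ s) (hlam : ∀ u, G ≤ u → 0 ≤ lam u)
    (hdec : ∀ j < N, G ≤ y j → y (j + 1) ≤ y j - T * lam (y j))
    (hinc : ∀ j < N, y (j + 1) ≤ y j + c) :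
    ∀ j ≤ N, y j ≤ G + c ∨ y j + j * T * lam (y j) ≤ s := by
  intro j
  induction j with
  | zero => intro _; right; simpa using hs
  | succ j ih =>
    intro hj
    rcases lt_or_ge (y j) G with h | h
    · left; linarith [hinc j hj]
    · have h1 := hdec j hj h
      have h2 : 0 ≤ T * lam (y j) := mul_nonneg hT (hlam _ h)
      rcases ih (by omega) with h3 | h3
      · left; linarith
      · right
        -- The sequence has just decreased, so the rate at its new value is at most the rate charged
        -- for each of the previous `j` steps and for the present one.
        have h4 : lam (y (j + 1)) ≤ lam (y j) := hm (by linarith)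
        have h5 : ((j : ℝ) + 1) * T * lam (y (j + 1)) ≤ (j + 1) * T * lam (y j) := by gcongr
        push_cast
        linarith

end ExtremumSeeking

end

/-! ### Averaging along curves on the torus with separated frequencies -/

noncomputable section

namespace ExtremumSeeking

/-- Lebesgue measure on the cube `(-π, π]ⁿ` of angles. -/
def torusMeasure (n : ℕ) : Measure (Fin n → ℝ) :=
  Measure.pi fun _ => volume.restrict (Ioc (-Real.pi) Real.pi)

instance (n : ℕ) : IsFiniteMeasure (torusMeasure n) := by
  unfold torusMeasure; infer_instance

theorem measurePreserving_snoc {n : ℕ} (ν : Measure ℝ) [SigmaFinite ν] :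
    MeasurePreserving (fun p : ℝ × (Fin n → ℝ) => (Fin.snoc p.2 p.1 : Fin (n + 1) → ℝ))
      (ν.prod (Measure.pi fun _ => ν)) (Measure.pi fun _ => ν) := by
  have h := (measurePreserving_piFinSuccAbove (fun _ : Fin (n + 1) => ν) (Fin.last n)).symm
  convert h using 1
  ext p i
  simp [MeasurableEquiv.piFinSuccAbove]

theorem measurableEmbedding_snoc {n : ℕ} :
    MeasurableEmbedding
      (fun p : ℝ × (Fin n → ℝ) => (Fin.snoc p.2 p.1 : Fin (n + 1) → ℝ)) := by
  have h := (MeasurableEquiv.piFinSuccAbove (fun _ : Fin (n + 1) => ℝ)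
    (Fin.last n)).symm.measurableEmbedding
  convert h using 1
  ext p i
  simp [MeasurableEquiv.piFinSuccAbove]

theorem lintegral_pi_snoc {n : ℕ} (ν : Measure ℝ) [SigmaFinite ν] {f : (Fin (n + 1) → ℝ) → ENNReal}
    (hf : Measurable f) :
    ∫⁻ x, f x ∂(Measure.pi fun _ => ν) =
      ∫⁻ s, ∫⁻ y, f (Fin.snoc y s) ∂(Measure.pi fun _ => ν) ∂ν := by
  rw [← (measurePreserving_snoc ν).lintegral_comp hf]
  exact lintegral_prod _ (hf.comp measurableEmbedding_snoc.measurable).aemeasurable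

theorem continuous_snoc {n : ℕ} :
    Continuous (fun p : ℝ × (Fin n → ℝ) => (Fin.snoc p.2 p.1 : Fin (n + 1) → ℝ)) := by
  refine continuous_pi fun i => ?_
  induction i using Fin.lastCases with
  | last => simpa using continuous_fst
  | cast i => simp only [Fin.snoc_castSucc]; fun_prop

theorem integrable_torus_of_continuous {n : ℕ} {E : Type*} [NormedAddCommGroup E]
    [SecondCountableTopology E] {F : (Fin n → ℝ) → E}
    (hF : Continuous F) : Integrable F (torusMeasure n) := by
  have hcomp : IsCompact (Icc (fun _ : Fin n => -Real.pi) (fun _ => Real.pi)) := isCompact_Icc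
  obtain ⟨C, hC⟩ := hcomp.exists_bound_of_continuousOn hF.continuousOn
  refine Integrable.of_bound hF.aestronglyMeasurable C ?_
  have : ∀ᵐ x ∂(torusMeasure n), ∀ i, x i ∈ Ioc (-Real.pi) Real.pi := by
    rw [ae_all_iff]
    intro i
    exact (Measure.tendsto_eval_ae_ae (μ := fun _ : Fin n => volume.restrict (Ioc (-Real.pi) Real.pi))
      (i := i)).eventually (ae_restrict_mem measurableSet_Ioc)
  filter_upwards [this] with x hx
  exact hC x ⟨fun i => (hx i).1.le, fun i => (hx i).2⟩

theorem integral_torus_succ {n : ℕ} {F : (Fin (n + 1) → ℝ) → ℝ} (hF : Continuous F) :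
    ∫ x, F x ∂(torusMeasure (n + 1)) =
      ∫ y, (∫ s in (-Real.pi)..Real.pi, F (Fin.snoc y s)) ∂(torusMeasure n) := by
  have hint := integrable_torus_of_continuous hF
  unfold torusMeasure at hint ⊢
  have hmp := measurePreserving_snoc (n := n) (volume.restrict (Ioc (-Real.pi) Real.pi))
  rw [← hmp.integral_comp measurableEmbedding_snoc]
  rw [← hmp.integrable_comp_emb measurableEmbedding_snoc] at hint
  refine (integral_prod_symm _ hint).trans ?_
  simp_rw [intervalIntegral.integral_of_le (show -Real.pi ≤ Real.pi by linarith [Real.pi_pos])]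
  rfl

/-- Averaging over a curve on the torus whose frequencies `N i` are widely separated. -/
theorem abs_curve_average_sub_torus_average_le {q : ℝ} (hq : 0 ≤ q) :
    ∀ (n : ℕ) (N : Fin n → ℕ) (F : (Fin n → ℝ) → ℝ) (L : NNReal), (∀ i, 0 < N i) →
      (∀ i j, i < j → (N i : ℝ) ≤ q * N j) → LipschitzWith L F →
      (∀ (θ : Fin n → ℝ) (z : Fin n → ℤ), F (fun i => θ i + z i * (2 * Real.pi)) = F θ) →
      |(2 * Real.pi)⁻¹ * (∫ τ in (-Real.pi)..Real.pi, F (fun i => N i * τ)) -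
        (2 * Real.pi)⁻¹ ^ n * ∫ θ, F θ ∂(torusMeasure n)| ≤ n * (L * (q * Real.pi)) := by
  have hπ := Real.pi_pos
  intro n
  induction n with
  | zero =>
    intro N F L _ _ _ _
    have h1 : ∀ θ : Fin 0 → ℝ, F θ = F 0 := fun θ => congrArg F (Subsingleton.elim _ _)
    have h2 : (torusMeasure 0).real univ = 1 := by simp [torusMeasure, Measure.real]
    simp only [h1, intervalIntegral.integral_const, integral_const, h2]
    simp only [sub_neg_eq_add, smul_eq_mul, pow_zero, one_mul, Nat.cast_zero, zero_mul]
    field_simp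
    norm_num
  | succ n ih =>
    intro N F L hN hNq hF hper
    have hFc := hF.continuous
    set M : ℕ := N (Fin.last n) with hM
    have hM0 : (0 : ℝ) < M := by exact_mod_cast hN _
    -- `G` is the mean of `F` over the fastest angle. It inherits the Lipschitz constant and the
    -- periodicity, so the induction hypothesis applies to it.
    let G : (Fin n → ℝ) → ℝ := fun y => (2 * Real.pi)⁻¹ * ∫ s in (-Real.pi)..Real.pi, F (Fin.snoc y s)
    have hsn : ∀ y : Fin n → ℝ, Continuous fun s : ℝ => F (Fin.snoc y s) := fun y =>
      hFc.comp (continuous_snoc.comp (by fun_prop : Continuous fun s : ℝ => (s, y)))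
    have hsndist : ∀ (y y' : Fin n → ℝ) (s : ℝ),
        |F (Fin.snoc y s) - F (Fin.snoc y' s)| ≤ L * dist y y' := fun y y' s => by
      rw [← Real.dist_eq]
      refine (hF.dist_le_mul _ _).trans ?_
      gcongr
      rw [dist_pi_le_iff dist_nonneg]
      intro i
      induction i using Fin.lastCases with
      | last => simp
      | cast i => simpa using dist_le_pi_dist y y' i
    have hG : LipschitzWith L G := by
      refine LipschitzWith.of_dist_le_mul fun y y' => ?_
      have h1 : ‖∫ s in (-Real.pi)..Real.pi, (F (Fin.snoc y s) - F (Fin.snoc y' s))‖ ≤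
          L * dist y y' * |Real.pi - -Real.pi| :=
        intervalIntegral.norm_integral_le_of_norm_le_const fun s _ => hsndist y y' s
      rw [intervalIntegral.integral_sub ((hsn y).intervalIntegrable _ _)
        ((hsn y').intervalIntegrable _ _), abs_of_pos (by linarith)] at h1
      rw [Real.dist_eq]
      simp only [G]
      rw [← mul_sub, abs_mul, abs_of_pos (by positivity), inv_mul_le_iff₀ (by positivity)]
      rw [Real.norm_eq_abs] at h1
      linarith
    have hGper : ∀ (θ : Fin n → ℝ) (z : Fin n → ℤ),
        G (fun i => θ i + z i * (2 * Real.pi)) = G θ := by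
      intro θ z
      simp only [G]
      congr 1
      refine intervalIntegral.integral_congr fun s _ => ?_
      have := hper (Fin.snoc θ s) (Fin.snoc z 0)
      rw [← this]
      congr 1
      ext i
      induction i using Fin.lastCases with
      | last => simp
      | cast i => simp
    have hih := ih (fun i => N i.castSucc) G L (fun i => hN _)
      (fun i j hij => hNq _ _ (by simpa using hij)) hG hGper
    have hGint : ∫ y, G y ∂(torusMeasure n) =
        (2 * Real.pi)⁻¹ * ∫ θ, F θ ∂(torusMeasure (n + 1)) := by
      rw [integral_torus_succ hFc, integral_const_mul]
    rw [hGint, ← mul_assoc, ← pow_succ] at hih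
    let f : ℝ → ℝ := fun τ => F (fun i => N i * τ)
    have hfc : Continuous f := hFc.comp (by fun_prop)
    have hfper : Function.Periodic f (2 * Real.pi) := fun τ => by
      have := hper (fun i => N i * τ) (fun i => N i)
      simp only [f]
      rw [← this]
      congr 1
      ext i
      push_cast
      ring
    have hshift : ∀ s : ℝ, ∫ τ in (-Real.pi)..Real.pi, f (τ + s) =
        ∫ τ in (-Real.pi)..Real.pi, f τ := fun s => by
      rw [intervalIntegral.integral_comp_add_right (fun τ => f τ)]
      have := hfper.intervalIntegral_add_eq (-Real.pi + s) (-Real.pi)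
      convert this using 2 <;> ring
    -- The integral over a period is invariant under the shift by s/M, and one averages over s ∈
    -- (-π, π]. Such shifts carry the fastest angle once around the circle but move each slower
    -- angle by at most qπ. Replacing them by a motion of the fastest angle alone therefore costs at
    -- most Lqπ and produces `G`.
    have hdouble : 2 * Real.pi * ∫ τ in (-Real.pi)..Real.pi, f τ =
        ∫ τ in (-Real.pi)..Real.pi, ∫ s in (-Real.pi)..Real.pi, f (τ + s / M) := by
      rw [intervalIntegral_intervalIntegral_swap]
      · simp_rw [hshift]
        rw [intervalIntegral.integral_const, smul_eq_mul]
        ring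
      · have hc : Continuous (Function.uncurry fun τ s => f (τ + s / M)) := by
          simp only [Function.uncurry_def]
          exact hfc.comp (by fun_prop)
        exact (hc.continuousOn.integrableOn_compact (isCompact_uIcc.prod isCompact_uIcc)).mono_set
          (prod_mono uIoc_subset_uIcc uIoc_subset_uIcc)
    have hGper' : ∀ τ : ℝ, ∫ s in (-Real.pi)..Real.pi, F (Fin.snoc (fun i => N i.castSucc * τ) (M * τ + s))
        = 2 * Real.pi * G (fun i => N i.castSucc * τ) := fun τ => by
      have hp : Function.Periodic (fun s : ℝ => F (Fin.snoc (fun i => N i.castSucc * τ) s))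
          (2 * Real.pi) := fun s => by
        have := hper (Fin.snoc (fun i : Fin n => N i.castSucc * τ) s) (Fin.snoc 0 1)
        simp only
        rw [← this]
        congr 1
        ext i
        induction i using Fin.lastCases with
        | last => simp
        | cast i => simp
      simp only [G]
      rw [intervalIntegral.integral_comp_add_left
        (fun s => F (Fin.snoc (fun i => N i.castSucc * τ) s))]
      have := hp.intervalIntegral_add_eq (M * τ + -Real.pi) (-Real.pi)
      rw [← mul_assoc, mul_inv_cancel₀ (by positivity), one_mul]
      convert this using 2 <;> ring
    have hclose : ∀ τ s : ℝ, s ∈ uIoc (-Real.pi) Real.pi →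
        ‖f (τ + s / M) - F (Fin.snoc (fun i => N i.castSucc * τ) (M * τ + s))‖ ≤
          L * (q * Real.pi) := fun τ s hs => by
      rw [uIoc_of_le (by linarith)] at hs
      have hs' : |s| ≤ Real.pi := abs_le.2 ⟨hs.1.le, hs.2⟩
      rw [← dist_eq_norm]
      refine (hF.dist_le_mul _ _).trans ?_
      gcongr
      rw [dist_pi_le_iff (by positivity)]
      intro i
      induction i using Fin.lastCases with
      | last =>
        rw [Fin.snoc_last, ← hM, mul_add, mul_div_cancel₀ _ hM0.ne', dist_self]
        positivity
      | cast i =>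
        rw [Fin.snoc_castSucc, Real.dist_eq]
        have h1 := hNq i.castSucc (Fin.last n) (Fin.castSucc_lt_last i)
        rw [← hM] at h1
        have h2 : (N i.castSucc : ℝ) * (τ + s / M) - N i.castSucc * τ = N i.castSucc / M * s := by
          field_simp; ring
        rw [h2, abs_mul, abs_of_nonneg (by positivity)]
        gcongr
        rwa [div_le_iff₀ hM0]
    have hstep : |2 * Real.pi * (∫ τ in (-Real.pi)..Real.pi, f τ) -
        ∫ τ in (-Real.pi)..Real.pi, 2 * Real.pi * G (fun i => N i.castSucc * τ)| ≤
          L * (q * Real.pi) * (2 * Real.pi) * (2 * Real.pi) := by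
      rw [hdouble, ← intervalIntegral.integral_sub]
      · rw [← Real.norm_eq_abs]
        refine (intervalIntegral.norm_integral_le_of_norm_le_const
          (C := L * (q * Real.pi) * (2 * Real.pi)) fun τ _ => ?_).trans_eq ?_
        · rw [← hGper', ← intervalIntegral.integral_sub]
          · refine (intervalIntegral.norm_integral_le_of_norm_le_const
              fun s hs => hclose τ s hs).trans_eq ?_
            rw [abs_of_pos (by linarith)]; ring
          · exact (hfc.comp (by fun_prop)).intervalIntegrable _ _
          · exact ((hsn _).comp (by fun_prop)).intervalIntegrable _ _
        · rw [abs_of_pos (by linarith)]; ring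
      · refine Continuous.intervalIntegrable ?_ _ _
        refine intervalIntegral.continuous_parametric_intervalIntegral_of_continuous' ?_ _ _
        exact hfc.comp (by fun_prop)
      · exact (continuous_const.mul (hG.continuous.comp (by fun_prop))).intervalIntegrable _ _
    rw [intervalIntegral.integral_const_mul, ← mul_sub, abs_mul,
      abs_of_pos (show 0 < 2 * Real.pi by positivity)] at hstep
    have hstep' : |(2 * Real.pi)⁻¹ * (∫ τ in (-Real.pi)..Real.pi, f τ) -
        (2 * Real.pi)⁻¹ * ∫ τ in (-Real.pi)..Real.pi, G (fun i => N i.castSucc * τ)| ≤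
          L * (q * Real.pi) := by
      rw [← mul_sub, abs_mul, abs_of_pos (by positivity), inv_mul_le_iff₀ (by positivity)]
      nlinarith
    calc _ ≤ _ := abs_sub_le _ ((2 * Real.pi)⁻¹ * ∫ τ in (-Real.pi)..Real.pi,
          G (fun i => N i.castSucc * τ)) _
      _ ≤ L * (q * Real.pi) + n * (L * (q * Real.pi)) := add_le_add hstep' hih
      _ = _ := by push_cast; ring

end ExtremumSeeking

end

/-! ### Integration in spherical coordinates -/

noncomputable section

namespace ExtremumSeeking

theorem prod_Ioi_castSucc {n : ℕ} (f : Fin (n + 1) → ℝ) (i : Fin n) :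
    ∏ l ∈ Finset.Ioi i.castSucc, f l = (∏ l ∈ Finset.Ioi i, f l.castSucc) * f (Fin.last n) := by
  have h : ∀ (k : ℕ) (j : Fin k) (h : Fin k → ℝ),
      ∏ l ∈ Finset.Ioi j, h l = ∏ l, if j < l then h l else 1 := fun k j h => by
    rw [← Finset.prod_filter]; congr 1; ext; simp
  rw [h, h, Fin.prod_univ_castSucc]
  simp [Fin.castSucc_lt_last]

/-- The last angle is a polar angle over the sphere of one dimension less. This recursion drives the
inductions on the dimension below. -/
theorem sphCoord_snoc {m : ℕ} (y : Fin (m + 1) → ℝ) (s : ℝ) :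
    (sphCoord (m + 1) (Fin.snoc y s)).ofLp =
      Fin.snoc (fun i => Real.sin s * (sphCoord m y).ofLp i) (Real.cos s) := by
  ext i
  induction i using Fin.lastCases with
  | last =>
    have h : (Fin.last (m + 1 + 1)) = Fin.succ (Fin.last (m + 1)) := rfl
    have h2 : Fin.last (m + 1) ≠ 0 := by simp [Fin.ext_iff]
    have h3 : Finset.Ioi (Fin.last (m + 1)) = ∅ := by ext x; simp [Fin.le_last]
    rw [Fin.snoc_last, h]
    simp [sphCoord, h2, h3]
  | cast i =>
    rw [Fin.snoc_castSucc]
    induction i using Fin.cases with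
    | zero =>
      have h := prod_Ioi_castSucc (fun l => Real.sin ((Fin.snoc y s : Fin (m + 2) → ℝ) l)) 0
      have h0 : (Fin.snoc y s : Fin (m + 2) → ℝ) 0 = y 0 := by
        rw [← Fin.castSucc_zero, Fin.snoc_castSucc (α := fun _ => ℝ)]
      simp only [Fin.snoc_castSucc, Fin.snoc_last, Fin.castSucc_zero] at h
      simp only [sphCoord, Fin.castSucc_zero, Fin.cons_zero, h, h0]
      ring
    | succ i =>
      have h := prod_Ioi_castSucc (fun l => Real.sin ((Fin.snoc y s : Fin (m + 2) → ℝ) l)) i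
      simp only [Fin.snoc_castSucc, Fin.snoc_last] at h
      simp only [sphCoord, Fin.castSucc_succ, Fin.cons_succ, h, Fin.snoc_castSucc,
        Fin.castSucc_eq_zero_iff]
      ring

theorem gramWeight_snoc {m : ℕ} (y : Fin (m + 1) → ℝ) (s : ℝ) :
    gramWeight (m + 1) (Fin.snoc y s) = |Real.sin s| ^ (m + 1) * gramWeight m y := by
  simp only [gramWeight]
  rw [Fin.prod_univ_castSucc, abs_mul, mul_comm]
  simp [abs_pow]

theorem continuous_sphCoord (m : ℕ) : Continuous (sphCoord m) := by
  refine (PiLp.continuous_toLp 2 _).comp (continuous_pi fun i => ?_)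
  induction i using Fin.cases with
  | zero => simp only [Fin.cons_zero]; fun_prop
  | succ i =>
    simp only [Fin.cons_succ]
    refine Continuous.mul ?_ (by fun_prop)
    split_ifs <;> fun_prop

theorem continuous_gramWeight (m : ℕ) : Continuous (gramWeight m) := by
  unfold gramWeight; fun_prop

theorem gramWeight_nonneg {m : ℕ} (θ : Fin (m + 1) → ℝ) : 0 ≤ gramWeight m θ := abs_nonneg _

theorem gramWeight_le_one {m : ℕ} (θ : Fin (m + 1) → ℝ) : gramWeight m θ ≤ 1 := by
  unfold gramWeight
  rw [Finset.abs_prod]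
  refine Finset.prod_le_one (fun _ _ => abs_nonneg _) fun i _ => ?_
  rw [abs_pow]
  exact pow_le_one₀ (abs_nonneg _) (Real.abs_sin_le_one _)

theorem norm_sphCoord {m : ℕ} (θ : Fin (m + 1) → ℝ) : ‖sphCoord m θ‖ = 1 := by
  rw [EuclideanSpace.norm_eq, Real.sqrt_eq_one]
  simp only [Real.norm_eq_abs, sq_abs]
  induction m with
  | zero => simp [sphCoord, Fin.sum_univ_succ]
  | succ m ih =>
    rw [← Fin.snoc_init_self θ, Fin.sum_univ_castSucc, sphCoord_snoc]
    simp only [Fin.snoc_castSucc, Fin.snoc_last, mul_pow]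
    rw [← Finset.mul_sum, ih, mul_one, Real.sin_sq_add_cos_sq]

/-- Integrand of the integral in spherical coordinates. -/
def polarIntegrand (m : ℕ) (f : (Fin (m + 2) → ℝ) → ENNReal) (r : ℝ) (θ : Fin (m + 1) → ℝ) :
    ENNReal :=
  ENNReal.ofReal (|r| ^ (m + 1) * gramWeight m θ) * f (fun i => r * (sphCoord m θ).ofLp i)

theorem measurable_polarIntegrand {m : ℕ} {f : (Fin (m + 2) → ℝ) → ENNReal} (hf : Measurable f) :
    Measurable (Function.uncurry (polarIntegrand m f)) := by
  have h1 := continuous_gramWeight m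
  have h2 : ∀ i, Continuous fun θ => (sphCoord m θ).ofLp i := fun i =>
    (PiLp.continuous_apply 2 _ i).comp (continuous_sphCoord m)
  refine Measurable.mul (by fun_prop) (hf.comp ?_)
  exact (continuous_pi fun i => continuous_fst.mul ((h2 i).comp continuous_snd)).measurable

/-- Negative radii contribute as much as positive ones, by the reflection x ↦ -x. They must be
included because in the induction on the dimension the lower-dimensional radius is r sin s, which
takes both signs for s in (-π, π]; each new angle thus doubles the covering number. -/
theorem lintegral_real_polarIntegrand {m : ℕ}
    (hP : ∀ f : (Fin (m + 2) → ℝ) → ENNReal, Measurable f →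
      ∫⁻ r in Ioi (0 : ℝ), ∫⁻ θ, polarIntegrand m f r θ ∂(torusMeasure (m + 1)) =
        2 ^ m * ∫⁻ x, f x) {f : (Fin (m + 2) → ℝ) → ENNReal} (hf : Measurable f) :
    ∫⁻ r : ℝ, ∫⁻ θ, polarIntegrand m f r θ ∂(torusMeasure (m + 1)) =
      2 ^ (m + 1) * ∫⁻ x, f x := by
  rw [← lintegral_add_compl _ (measurableSet_Ioi (a := (0 : ℝ))), hP f hf, compl_Ioi,
    setLIntegral_congr Iio_ae_eq_Iic.symm]
  have h2 : ∫⁻ r in Iio (0 : ℝ), ∫⁻ θ, polarIntegrand m f r θ ∂(torusMeasure (m + 1)) =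
      ∫⁻ r in Ioi (0 : ℝ), ∫⁻ θ, polarIntegrand m (fun x => f (-x)) r θ
        ∂(torusMeasure (m + 1)) := by
    have h := (Measure.measurePreserving_neg (volume : Measure ℝ)).setLIntegral_comp_preimage_emb
      (MeasurableEquiv.neg ℝ).measurableEmbedding
      (fun r => ∫⁻ θ, polarIntegrand m f r θ ∂(torusMeasure (m + 1))) (Iio 0)
    rw [← h]
    have hs : (Neg.neg ⁻¹' Iio (0 : ℝ)) = Ioi 0 := by ext; simp
    rw [hs]
    refine lintegral_congr fun r => lintegral_congr fun θ => ?_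
    simp only [polarIntegrand, abs_neg]
    congr 2
    ext i
    simp
  have h3 := hP _ (hf.comp measurable_neg)
  simp only [Function.comp_def] at h3
  rw [h2, h3,
    (Measure.measurePreserving_neg (volume : Measure (Fin (m + 2) → ℝ))).lintegral_comp hf,
    pow_succ, ← two_mul]
  ring

/-- Integration in spherical coordinates, all angles ranging over `(-π, π]`. -/
theorem lintegral_polarIntegrand (m : ℕ) : ∀ f : (Fin (m + 2) → ℝ) → ENNReal, Measurable f →
    ∫⁻ r in Ioi (0 : ℝ), ∫⁻ θ, polarIntegrand m f r θ ∂(torusMeasure (m + 1)) =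
      2 ^ m * ∫⁻ x, f x := by
  -- Plane polar coordinates, with the angle π added as a null set.
  have hpolar : ∀ h : ℝ × ℝ → ENNReal, Measurable h →
      ∫⁻ r in Ioi (0 : ℝ), ∫⁻ s in Ioc (-Real.pi) Real.pi,
        ENNReal.ofReal r * h (r * Real.cos s, r * Real.sin s) = ∫⁻ p, h p := by
    intro h hh
    rw [← lintegral_comp_polarCoord_symm]
    have ht : polarCoord.target = Ioi 0 ×ˢ Ioo (-Real.pi) Real.pi := rfl
    rw [ht, Measure.volume_eq_prod, ← Measure.prod_restrict, lintegral_prod]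
    · simp only [polarCoord_symm_apply, smul_eq_mul]
      refine lintegral_congr fun r => ?_
      exact (setLIntegral_congr Ioo_ae_eq_Ioc).symm
    · simp only [polarCoord_symm_apply]
      exact Measurable.aemeasurable (by fun_prop)
  induction m with
  | zero =>
    intro f hf
    have h2 := (volume_preserving_finTwoArrow ℝ).symm.lintegral_comp hf
    rw [pow_zero, one_mul, ← h2,
      ← hpolar (fun p => f (MeasurableEquiv.finTwoArrow.symm p))
        (hf.comp (MeasurableEquiv.finTwoArrow (α := ℝ)).symm.measurable)]
    refine setLIntegral_congr_fun measurableSet_Ioi fun r hr => ?_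
    have hm : Measurable (polarIntegrand 0 f r) := (measurable_polarIntegrand hf).of_uncurry_left
    unfold torusMeasure
    rw [lintegral_pi_snoc _ hm]
    refine lintegral_congr fun s => ?_
    rw [Measure.pi_of_empty (fun _ => volume.restrict (Ioc (-Real.pi) Real.pi)), lintegral_dirac]
    have hr' : |r| = r := abs_of_pos hr
    simp only [polarIntegrand, hr', gramWeight]
    congr 1
    · simp
    · congr 1
      ext i
      fin_cases i
      · simp [sphCoord]; left; rfl
      · simp [sphCoord]; left; rfl
  | succ m ih =>
    intro f hf
    have h1 : ∫⁻ x, f x = ∫⁻ z : ℝ, ∫⁻ y : Fin (m + 2) → ℝ, f (Fin.snoc y z) :=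
      lintegral_pi_snoc volume hf
    have hfz : ∀ z : ℝ, Measurable fun y : Fin (m + 2) → ℝ => f (Fin.snoc y z) := fun z =>
      hf.comp (measurableEmbedding_snoc.measurable.comp
        (by fun_prop : Measurable fun y : Fin (m + 2) → ℝ => (z, y)))
    -- Here `p.1` is the last Cartesian coordinate and `p.2` the signed radius of the remaining
    -- ones; polar coordinates in this plane supply the new radius and the new angle.
    let h : ℝ × ℝ → ENNReal := fun p =>
      ∫⁻ θ, polarIntegrand m (fun y => f (Fin.snoc y p.1)) p.2 θ ∂(torusMeasure (m + 1))
    have hmeas : Measurable fun q : (ℝ × ℝ) × (Fin (m + 1) → ℝ) =>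
        polarIntegrand m (fun y => f (Fin.snoc y q.1.1)) q.1.2 q.2 := by
      have h1 := continuous_gramWeight m
      have h2 : ∀ i, Continuous fun θ => (sphCoord m θ).ofLp i := fun i =>
        (PiLp.continuous_apply 2 _ i).comp (continuous_sphCoord m)
      refine Measurable.mul (by fun_prop) (hf.comp ?_)
      exact ((continuous_snoc (n := m + 2)).comp
        ((continuous_fst.comp continuous_fst).prodMk (continuous_pi fun i =>
          (continuous_snd.comp continuous_fst).mul ((h2 i).comp continuous_snd)))).measurable
    have hh : Measurable h := hmeas.lintegral_prod_right'
    have h2 : 2 ^ (m + 1) * ∫⁻ x, f x = ∫⁻ p, h p := by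
      rw [h1, Measure.volume_eq_prod, lintegral_prod _ hh.aemeasurable, ← lintegral_const_mul']
      · refine lintegral_congr fun z => ?_
        exact (lintegral_real_polarIntegrand ih (hfz z)).symm
      · finiteness
    rw [h2, ← hpolar h hh]
    refine setLIntegral_congr_fun measurableSet_Ioi fun r hr => ?_
    have hm : Measurable (polarIntegrand (m + 1) f r) :=
      (measurable_polarIntegrand hf).of_uncurry_left
    unfold torusMeasure
    rw [lintegral_pi_snoc _ hm]
    refine lintegral_congr fun s => ?_
    simp only [h]
    rw [← lintegral_const_mul' _ _ ENNReal.ofReal_ne_top]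
    refine lintegral_congr fun y => ?_
    have hr' : |r| = r := abs_of_pos hr
    have hr0 : 0 ≤ r := (mem_Ioi.1 hr).le
    simp only [polarIntegrand]
    rw [← mul_assoc, ← ENNReal.ofReal_mul hr0, gramWeight_snoc, sphCoord_snoc]
    congr 1
    · congr 1
      rw [abs_mul, hr']
      ring
    · congr 1
      ext i
      induction i using Fin.lastCases with
      | last => simp
      | cast i => simp [mul_assoc]

end ExtremumSeeking

end

/-! ### The gradient of a ball average as a spherical integral -/

noncomputable section

namespace ExtremumSeeking

/-- The density of Lebesgue measure in spherical coordinates. -/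
def polarDensity (m : ℕ) (p : ℝ × (Fin (m + 1) → ℝ)) : NNReal :=
  Real.toNNReal (|p.1| ^ (m + 1) * gramWeight m p.2)

theorem measurable_polarDensity (m : ℕ) : Measurable (polarDensity m) := by
  have := continuous_gramWeight m
  unfold polarDensity
  exact Measurable.real_toNNReal (by fun_prop)

theorem continuous_polarMap (m : ℕ) :
    Continuous fun p : ℝ × (Fin (m + 1) → ℝ) => p.1 • sphCoord m p.2 :=
  continuous_fst.smul ((continuous_sphCoord m).comp continuous_snd)

/-- Stating the change of variables as a push-forward of measures transfers the formula for
nonnegative functions to Bochner integrals; indicators of measurable sets suffice to prove it. -/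
theorem map_polarMap (m : ℕ) :
    (((volume.restrict (Ioi (0 : ℝ))).prod (torusMeasure (m + 1))).withDensity
      (fun p => (polarDensity m p : ENNReal))).map (fun p => p.1 • sphCoord m p.2) =
      (2 ^ m : NNReal) • (volume : Measure (State m)) := by
  have hmeas := (continuous_polarMap m).measurable
  refine Measure.ext fun s hs => ?_
  have hind : Measurable (s.indicator (1 : State m → ENNReal)) := measurable_one.indicator hs
  have hf : Measurable fun x : Fin (m + 2) → ℝ =>
      s.indicator (1 : State m → ENNReal) (WithLp.toLp 2 x) :=
    hind.comp (PiLp.volume_preserving_toLp (Fin (m + 2))).measurable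
  have h := lintegral_polarIntegrand m _ hf
  have h2 := (PiLp.volume_preserving_toLp (Fin (m + 2))).lintegral_comp hind
  rw [h2] at h
  rw [← lintegral_indicator_one hs, lintegral_map hind hmeas,
    lintegral_withDensity_eq_lintegral_mul _ (measurable_polarDensity m).coe_nnreal_ennreal
      (g := fun p => s.indicator 1 (p.1 • sphCoord m p.2)) (hind.comp hmeas), lintegral_prod]
  · rw [Measure.smul_apply, ← lintegral_indicator_one hs]
    have h3 : ((2 ^ m : NNReal) • ∫⁻ a, s.indicator (1 : State m → ENNReal) a) =
        2 ^ m * ∫⁻ a, s.indicator (1 : State m → ENNReal) a := by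
      rw [ENNReal.smul_def, smul_eq_mul]; push_cast; rfl
    rw [h3, ← h]
    rfl
  · exact ((measurable_polarDensity m).coe_nnreal_ennreal.mul (hind.comp hmeas)).aemeasurable

/-- Bochner integral in spherical coordinates. -/
theorem integral_polar {m : ℕ} {f : State m → ℝ} (hf : Integrable f) :
    2 ^ m * ∫ x, f x = ∫ θ, gramWeight m θ * (∫ r in Ioi (0 : ℝ),
      r ^ (m + 1) * f (r • sphCoord m θ)) ∂(torusMeasure (m + 1)) := by
  have hmeas := (continuous_polarMap m).measurable
  have hmap := map_polarMap m
  have hf2 : Integrable f ((2 ^ m : NNReal) • (volume : Measure (State m))) :=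
    hf.smul_measure_nnreal
  have hfae := hf2.aestronglyMeasurable
  rw [← hmap] at hf2 hfae
  rw [integrable_map_measure hfae hmeas.aemeasurable,
    integrable_withDensity_iff_integrable_smul (measurable_polarDensity m)] at hf2
  have h1 : 2 ^ m * ∫ x, f x = ∫ x, f x ∂((2 ^ m : NNReal) • (volume : Measure (State m))) := by
    rw [integral_smul_nnreal_measure, NNReal.smul_def]; simp
  simp only [Function.comp_def] at hf2
  rw [h1, ← hmap, integral_map hmeas.aemeasurable hfae,
    integral_withDensity_eq_integral_smul (measurable_polarDensity m), integral_prod_symm _ hf2]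
  refine integral_congr_ae (Eventually.of_forall fun θ => ?_)
  simp only
  rw [← integral_const_mul]
  refine setIntegral_congr_fun measurableSet_Ioi fun r hr => ?_
  have hr0 : 0 < r := hr
  simp only [polarDensity, NNReal.smul_def, smul_eq_mul]
  rw [Real.coe_toNNReal _ (mul_nonneg (by positivity) (gramWeight_nonneg θ)), abs_of_pos hr0]
  ring

/-- The distance from the origin, in the direction of the unit vector `σ`, to the unit sphere
centered at `h • p`, where `c = ⟪σ, p⟫` and `q = ‖p‖ ^ 2`. -/
def shiftRadius (c q h : ℝ) : ℝ := h * c + √(1 - h ^ 2 * q + h ^ 2 * c ^ 2)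

/-- Membership is a quadratic inequality for `r`, with roots hc ± √(1 - h²q + h²c²). Since the
origin is interior to the ball, the lower root is negative and only the upper one restricts positive
`r`. -/
theorem mem_closedBall_iff_le_shiftRadius {m : ℕ} {σ p : State m} (hσ : ‖σ‖ = 1) {h r : ℝ}
    (hh : h ^ 2 * ‖p‖ ^ 2 < 1) (hr : 0 < r) :
    r • σ ∈ Metric.closedBall (h • p) 1 ↔ r ≤ shiftRadius (inner ℝ σ p) (‖p‖ ^ 2) h := by
  rw [mem_closedBall_iff_norm, ← sq_le_one_iff₀ (norm_nonneg _), norm_sub_sq_real, norm_smul,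
    norm_smul, inner_smul_left, inner_smul_right, hσ]
  simp only [Real.norm_eq_abs, conj_trivial, mul_one, mul_pow, sq_abs]
  set c := inner ℝ σ p
  have h0 : 0 < 1 - h ^ 2 * ‖p‖ ^ 2 + h ^ 2 * c ^ 2 := by nlinarith [sq_nonneg (h * c)]
  have hs := Real.sq_sqrt h0.le
  have hs0 := Real.sqrt_nonneg (1 - h ^ 2 * ‖p‖ ^ 2 + h ^ 2 * c ^ 2)
  unfold shiftRadius
  set s := √(1 - h ^ 2 * ‖p‖ ^ 2 + h ^ 2 * c ^ 2)
  have hsc : |h * c| < s := by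
    rw [← sq_lt_sq₀ (abs_nonneg _) hs0, sq_abs]; nlinarith
  have hsc' := abs_lt.1 hsc
  constructor
  · intro hle
    have : (r - h * c) ^ 2 ≤ s ^ 2 := by nlinarith
    linarith [(abs_le_of_sq_le_sq' this hs0).2]
  · intro hle
    have : (r - h * c) ^ 2 ≤ s ^ 2 := sq_le_sq' (by linarith [hsc'.1]) (by linarith)
    nlinarith

theorem shiftRadius_pos {c q h : ℝ} (hh : h ^ 2 * q < 1) : 0 < shiftRadius c q h := by
  have h0 : 0 < 1 - h ^ 2 * q + h ^ 2 * c ^ 2 := by nlinarith [sq_nonneg (h * c)]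
  have hs := Real.sq_sqrt h0.le
  have hs0 := Real.sqrt_nonneg (1 - h ^ 2 * q + h ^ 2 * c ^ 2)
  unfold shiftRadius
  set s := √(1 - h ^ 2 * q + h ^ 2 * c ^ 2)
  have hsc : |h * c| < s := by
    rw [← sq_lt_sq₀ (abs_nonneg _) hs0, sq_abs]; nlinarith
  linarith [(abs_lt.1 hsc).1]

/-- At h = 0 the derivative is c, the normal component of the translation velocity. -/
theorem hasDerivAt_shiftRadius {c q h : ℝ} (hh : h ^ 2 * q < 1) :
    HasDerivAt (shiftRadius c q)
      (c + h * (c ^ 2 - q) / √(1 - h ^ 2 * q + h ^ 2 * c ^ 2)) h := by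
  have h0 : 0 < 1 - h ^ 2 * q + h ^ 2 * c ^ 2 := by nlinarith [sq_nonneg (h * c)]
  have h1 : HasDerivAt (fun h : ℝ => 1 - h ^ 2 * q + h ^ 2 * c ^ 2) (2 * h * (c ^ 2 - q)) h := by
    have h2 := hasDerivAt_pow 2 h
    refine (((h2.mul_const q).const_sub 1).add (h2.mul_const (c ^ 2))).congr_deriv ?_
    simp; ring
  refine ((hasDerivAt_mul_const c).add (h1.sqrt h0.ne')).congr_deriv ?_
  field_simp

/-- Integral over a shifted unit ball, in spherical coordinates about the origin. -/
theorem integral_closedBall_polar {m : ℕ} {F : State m → ℝ} (hF : Continuous F) {p : State m}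
    {h : ℝ} (hh : h ^ 2 * ‖p‖ ^ 2 < 1) :
    2 ^ m * ∫ x in Metric.closedBall (0 : State m) 1, F (x + h • p) =
      ∫ θ, gramWeight m θ * (∫ r in (0 : ℝ)..shiftRadius (inner ℝ (sphCoord m θ) p) (‖p‖ ^ 2) h,
      r ^ (m + 1) * F (r • sphCoord m θ)) ∂(torusMeasure (m + 1)) := by
  have hmeas : MeasurableSet (Metric.closedBall (h • p) (1 : ℝ)) := measurableSet_closedBall
  have h1 : ∫ x in Metric.closedBall (0 : State m) 1, F (x + h • p) =
      ∫ x, (Metric.closedBall (h • p) 1).indicator F x := by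
    rw [← integral_add_right_eq_self ((Metric.closedBall (h • p) 1).indicator F) (h • p),
      ← integral_indicator measurableSet_closedBall]
    congr 1
    ext x
    simp only [indicator, Metric.mem_closedBall, dist_eq_norm, sub_zero, add_sub_cancel_right]
  have hint : Integrable ((Metric.closedBall (h • p) 1).indicator F) := by
    rw [integrable_indicator_iff hmeas]
    exact hF.continuousOn.integrableOn_compact (isCompact_closedBall _ _)
  rw [h1, integral_polar hint]
  refine integral_congr_ae (Eventually.of_forall fun θ => ?_)
  simp only
  congr 1
  have hR := (shiftRadius_pos (c := inner ℝ (sphCoord m θ) p) hh).le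
  set R := shiftRadius (inner ℝ (sphCoord m θ) p) (‖p‖ ^ 2) h
  rw [intervalIntegral.integral_of_le hR, ← integral_indicator measurableSet_Ioi,
    ← integral_indicator measurableSet_Ioc]
  congr 1
  ext r
  simp only [indicator, mem_Ioi, mem_Ioc]
  by_cases hr : 0 < r
  · have := mem_closedBall_iff_le_shiftRadius (norm_sphCoord θ) hh hr
    by_cases hr2 : r ≤ R
    · simp only [hr, hr2, this.2 hr2, if_true, and_self]
    · simp only [hr, hr2, mt this.1 hr2, if_true, if_false, and_false, mul_zero]
  · simp [hr]

/-- The derivative of the integral over a moving unit ball is a surface integral. -/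
theorem hasDerivAt_integral_closedBall {m : ℕ} {F : State m → ℝ} (hF : Continuous F)
    (p : State m) :
    HasDerivAt (fun h : ℝ => 2 ^ m * ∫ x in Metric.closedBall (0 : State m) 1, F (x + h • p))
      (∫ θ, gramWeight m θ * (F (sphCoord m θ) * inner ℝ (sphCoord m θ) p)
        ∂(torusMeasure (m + 1))) 0 := by
  set P := ‖p‖ with hP
  have hP0 : 0 ≤ P := norm_nonneg p
  set δ : ℝ := (2 * (1 + P))⁻¹ with hδ
  have hδ0 : 0 < δ := by positivity
  have hδP : δ * P ≤ 1 / 2 := by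
    rw [hδ, inv_mul_le_iff₀ (by positivity)]; linarith
  have hsmall : ∀ h ∈ Metric.ball (0 : ℝ) δ, |h| * P ≤ 1 / 2 := fun h hh => by
    rw [mem_ball_zero_iff, Real.norm_eq_abs] at hh
    nlinarith
  have hsq : ∀ h ∈ Metric.ball (0 : ℝ) δ, h ^ 2 * P ^ 2 ≤ 1 / 4 := fun h hh => by
    have := hsmall h hh
    have h2 : h ^ 2 * P ^ 2 = (|h| * P) ^ 2 := by rw [mul_pow, sq_abs]
    rw [h2]
    nlinarith [mul_nonneg (abs_nonneg h) hP0]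
  have hball : Metric.ball (0 : ℝ) δ ∈ 𝓝 (0 : ℝ) := Metric.ball_mem_nhds _ hδ0
  obtain ⟨C, hC⟩ := (isCompact_closedBall (0 : State m) 2).exists_bound_of_continuousOn
    hF.continuousOn
  have hC0 : 0 ≤ C := (norm_nonneg _).trans (hC 0 (by simp))
  let c : (Fin (m + 1) → ℝ) → ℝ := fun θ => inner ℝ (sphCoord m θ) p
  have hsph := continuous_sphCoord m
  have hgram := continuous_gramWeight m
  have hc : Continuous c := hsph.inner continuous_const
  have hcP : ∀ θ, |c θ| ≤ P := fun θ => by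
    simpa [norm_sphCoord] using abs_real_inner_le_norm (sphCoord m θ) p
  let G : ℝ → (Fin (m + 1) → ℝ) → ℝ := fun h θ =>
    gramWeight m θ * ∫ r in (0 : ℝ)..shiftRadius (c θ) (P ^ 2) h, r ^ (m + 1) * F (r • sphCoord m θ)
  -- The integrand at the upper limit times the derivative of that limit. At h = 0 the radius is 1
  -- and only the boundary term of the unit sphere remains.
  let G' : ℝ → (Fin (m + 1) → ℝ) → ℝ := fun h θ =>
    gramWeight m θ * (shiftRadius (c θ) (P ^ 2) h ^ (m + 1) *
      F (shiftRadius (c θ) (P ^ 2) h • sphCoord m θ) *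
      (c θ + h * (c θ ^ 2 - P ^ 2) / √(1 - h ^ 2 * P ^ 2 + h ^ 2 * c θ ^ 2)))
  have hunc : Continuous (Function.uncurry fun (θ : Fin (m + 1) → ℝ) (r : ℝ) =>
      r ^ (m + 1) * F (r • sphCoord m θ)) := by
    simp only [Function.uncurry_def]
    exact (by fun_prop : Continuous fun x : (Fin (m + 1) → ℝ) × ℝ => x.2 ^ (m + 1)).mul
      (hF.comp (continuous_snd.smul (hsph.comp continuous_fst)))
  have hGc : ∀ h, Continuous (G h) := fun h => by
    refine hgram.mul ?_
    refine intervalIntegral.continuous_parametric_intervalIntegral_of_continuous hunc ?_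
    unfold shiftRadius
    fun_prop
  have hG'0 : ∀ θ, G' 0 θ = gramWeight m θ * (F (sphCoord m θ) * inner ℝ (sphCoord m θ) p) :=
    fun θ => by simp [G', shiftRadius, c]
  have hmain := hasDerivAt_integral_of_dominated_loc_of_deriv_le (μ := torusMeasure (m + 1))
    (F := G) (F' := G') (x₀ := (0 : ℝ)) (bound := fun _ => 2 ^ (m + 1) * C * (3 * P)) hball
    (Eventually.of_forall fun h => (hGc h).aestronglyMeasurable)
    (integrable_torus_of_continuous (hGc 0))
    (by
      refine Continuous.aestronglyMeasurable ?_
      simp only [funext hG'0]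
      exact hgram.mul ((hF.comp hsph).mul (hsph.inner continuous_const)))
    (Eventually.of_forall fun θ h hh => by
      have h1 := hsq h hh
      have h2 := hsmall h hh
      have h3 := hcP θ
      have hcs : c θ ^ 2 ≤ P ^ 2 := sq_le_sq' (by linarith [(abs_le.1 h3).1]) (abs_le.1 h3).2
      have hrad : (1 / 2 : ℝ) ≤ √(1 - h ^ 2 * P ^ 2 + h ^ 2 * c θ ^ 2) :=
        Real.le_sqrt_of_sq_le (by nlinarith [mul_nonneg (sq_nonneg h) (sq_nonneg (c θ))])
      have hrad2 : √(1 - h ^ 2 * P ^ 2 + h ^ 2 * c θ ^ 2) ≤ 1 := by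
        refine Real.sqrt_le_iff.2 ⟨zero_le_one, ?_⟩
        nlinarith [sq_nonneg h]
      have hRpos := shiftRadius_pos (c := c θ) (q := P ^ 2) (h := h) (by linarith)
      have hR2 : shiftRadius (c θ) (P ^ 2) h ≤ 2 := by
        have : h * c θ ≤ 1 / 2 := by
          calc h * c θ ≤ |h * c θ| := le_abs_self _
            _ = |h| * |c θ| := abs_mul _ _
            _ ≤ |h| * P := by gcongr
            _ ≤ _ := h2
        unfold shiftRadius
        linarith
      have hFb : |F (shiftRadius (c θ) (P ^ 2) h • sphCoord m θ)| ≤ C := by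
        refine hC _ ?_
        rw [mem_closedBall_zero_iff, norm_smul, norm_sphCoord, mul_one, Real.norm_eq_abs,
          abs_of_pos hRpos]
        exact hR2
      have hder : |c θ + h * (c θ ^ 2 - P ^ 2) / √(1 - h ^ 2 * P ^ 2 + h ^ 2 * c θ ^ 2)| ≤
          3 * P := by
        have h4 : |h * (c θ ^ 2 - P ^ 2) / √(1 - h ^ 2 * P ^ 2 + h ^ 2 * c θ ^ 2)| ≤ P := by
          rw [abs_div, abs_of_pos (by linarith : 0 < √(1 - h ^ 2 * P ^ 2 + h ^ 2 * c θ ^ 2)),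
            div_le_iff₀ (by linarith), abs_mul]
          have h5 : |c θ ^ 2 - P ^ 2| ≤ P ^ 2 := by
            rw [abs_le]; constructor <;> nlinarith [sq_nonneg (c θ)]
          calc |h| * |c θ ^ 2 - P ^ 2| ≤ |h| * P ^ 2 := by gcongr
            _ = (|h| * P) * P := by ring
            _ ≤ 1 / 2 * P := by gcongr
            _ = P * (1 / 2) := by ring
            _ ≤ _ := by gcongr
        refine (abs_add_le _ _).trans ?_
        linarith
      rw [Real.norm_eq_abs]
      simp only [G']
      rw [abs_mul, abs_mul, abs_mul, abs_of_nonneg (gramWeight_nonneg θ), abs_pow, abs_of_pos hRpos]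
      calc gramWeight m θ * (shiftRadius (c θ) (P ^ 2) h ^ (m + 1) *
            |F (shiftRadius (c θ) (P ^ 2) h • sphCoord m θ)| * _)
          ≤ 1 * (2 ^ (m + 1) * C * (3 * P)) := by
            gcongr
            exact gramWeight_le_one θ
        _ = _ := one_mul _)
    (integrable_const _)
    (Eventually.of_forall fun θ h hh => by
      have h1 := hsq h hh
      refine HasDerivAt.const_mul _ ?_
      have hfc : Continuous fun r : ℝ => r ^ (m + 1) * F (r • sphCoord m θ) := by
        have : Continuous fun r : ℝ => r • sphCoord m θ := by fun_prop
        exact (continuous_pow _).mul (hF.comp this)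
      have h2 := intervalIntegral.integral_hasDerivAt_right (hfc.intervalIntegrable 0
        (shiftRadius (c θ) (P ^ 2) h)) (hfc.stronglyMeasurableAtFilter _ _) hfc.continuousAt
      exact h2.comp h (hasDerivAt_shiftRadius (by linarith)))
  have h2 := hmain.2
  simp only [hG'0] at h2
  refine h2.congr_of_eventuallyEq ?_
  filter_upwards [hball] with h hh
  have h3 := hsq h hh
  exact integral_closedBall_polar hF (by rw [← hP]; linarith)

/-- The average of `f` over a sphere against the normal is the gradient of the ball average. -/
theorem integral_torus_eq_inner_gradient_avgObj {m : ℕ} {f : State m → ℝ} (hf : Continuous f)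
    (a : ℝ) (x p : State m) (hd : DifferentiableAt ℝ (avgObj f a) x) :
    ∫ θ, gramWeight m θ * (f (x + a • sphCoord m θ) * inner ℝ (sphCoord m θ) p)
        ∂(torusMeasure (m + 1)) =
      2 ^ m * a * volume.real (Metric.closedBall (0 : State m) 1) *
        inner ℝ (gradient (avgObj f a) x) p := by
  have hF : Continuous fun y : State m => f (x + a • y) := by fun_prop
  have h1 := hasDerivAt_integral_closedBall hF p
  have hvol : volume.real (Metric.closedBall (0 : State m) 1) ≠ 0 := by
    rw [Measure.real, ENNReal.toReal_ne_zero]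
    exact ⟨(Metric.measure_closedBall_pos volume _ one_pos).ne', measure_closedBall_lt_top.ne⟩
  -- Shifting the unit ball by h p in the rescaled variable shifts the centre x by h a p, so the
  -- derivative just computed is also a directional derivative of the average.
  have h2 : HasDerivAt (fun h : ℝ => avgObj f a (x + h • (a • p)))
      (fderiv ℝ (avgObj f a) x (a • p)) 0 := by
    have h3 : HasDerivAt (fun h : ℝ => x + h • (a • p)) (a • p) 0 := by
      simpa using ((hasDerivAt_id (0 : ℝ)).smul_const (a • p)).const_add x
    have h4 : HasFDerivAt (avgObj f a) (fderiv ℝ (avgObj f a) x) (x + (0 : ℝ) • (a • p)) := by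
      simpa using hd.hasFDerivAt
    exact h4.comp_hasDerivAt (0 : ℝ) h3
  have h5 := h2.const_mul (2 ^ m * volume.real (Metric.closedBall (0 : State m) 1))
  have h6 := h1.unique (h5.congr_of_eventuallyEq (Eventually.of_forall fun h => ?_))
  · rw [h6, map_smul, smul_eq_mul, ← inner_gradient_left]
    ring
  · simp only [avgObj]
    rw [mul_assoc, ← mul_assoc (volume.real _), mul_inv_cancel₀ hvol, one_mul]
    congr 2
    ext y
    congr 1
    module

end ExtremumSeeking

end

/-! ### Regularity of the averaged objective, the averaging error, and truncation -/

noncomputable section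

namespace ExtremumSeeking

theorem volume_real_closedBall_pos (m : ℕ) :
    0 < volume.real (Metric.closedBall (0 : State m) 1) := by
  rw [Measure.real]
  exact ENNReal.toReal_pos (Metric.measure_closedBall_pos volume _ one_pos).ne'
    measure_closedBall_lt_top.ne

theorem hasFDerivAt_avgObj {m : ℕ} {f : State m → ℝ} {C : NNReal} (hf : ContDiff ℝ 1 f)
    (hC : LipschitzWith C f) (a : ℝ) (x : State m) :
    HasFDerivAt (avgObj f a) ((volume.real (Metric.closedBall (0 : State m) 1))⁻¹ •
      ∫ ξ in Metric.closedBall (0 : State m) 1, fderiv ℝ f (x + a • ξ)) x := by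
  have hfc := hf.continuous
  have hf'c : Continuous (fderiv ℝ f) := hf.continuous_fderiv one_ne_zero
  have hcomp := isCompact_closedBall (0 : State m) (1 : ℝ)
  have hfin : IsFiniteMeasure (volume.restrict (Metric.closedBall (0 : State m) 1)) :=
    ⟨by rw [Measure.restrict_apply_univ]; exact measure_closedBall_lt_top⟩
  have h := hasFDerivAt_integral_of_dominated_of_fderiv_le
    (μ := volume.restrict (Metric.closedBall (0 : State m) 1)) (s := univ) (x₀ := x)
    (F := fun x ξ => f (x + a • ξ)) (F' := fun x ξ => fderiv ℝ f (x + a • ξ))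
    (bound := fun _ => (C : ℝ)) univ_mem
    (Eventually.of_forall fun y => Continuous.aestronglyMeasurable (by fun_prop))
    (Continuous.continuousOn (by fun_prop) |>.integrableOn_compact hcomp)
    (Continuous.aestronglyMeasurable (by fun_prop))
    (Eventually.of_forall fun ξ y _ => norm_fderiv_le_of_lipschitz ℝ hC)
    (integrable_const _)
    (Eventually.of_forall fun ξ y _ => by
      have h1 := (hf.differentiable one_ne_zero (y + a • ξ)).hasFDerivAt
      exact (hasFDerivAt_comp_add_right (a • ξ)).2 h1)
  exact h.const_mul _

theorem lipschitzWith_gradient_avgObj {m : ℕ} {f : State m → ℝ} {C L : NNReal}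
    (hf : ContDiff ℝ 1 f) (hC : LipschitzWith C f) (hL : LipschitzWith L (fderiv ℝ f)) (a : ℝ) :
    LipschitzWith L (gradient (avgObj f a)) := by
  have hf'c : Continuous (fderiv ℝ f) := hf.continuous_fderiv one_ne_zero
  have hcomp := isCompact_closedBall (0 : State m) (1 : ℝ)
  have hv := volume_real_closedBall_pos m
  refine LipschitzWith.of_dist_le_mul fun x y => ?_
  unfold gradient
  rw [LinearIsometryEquiv.dist_map, (hasFDerivAt_avgObj hf hC a x).fderiv,
    (hasFDerivAt_avgObj hf hC a y).fderiv, dist_eq_norm, ← smul_sub, ← integral_sub, norm_smul,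
    Real.norm_eq_abs, abs_of_pos (by positivity), inv_mul_le_iff₀ hv]
  · refine (norm_setIntegral_le_of_norm_le_const (C := L * dist x y) measure_closedBall_lt_top
      fun ξ _ => ?_).trans_eq (mul_comm _ _)
    rw [← dist_eq_norm]
    refine (hL.dist_le_mul _ _).trans_eq ?_
    rw [dist_add_right]
  · exact Continuous.continuousOn (by fun_prop) |>.integrableOn_compact hcomp
  · exact Continuous.continuousOn (by fun_prop) |>.integrableOn_compact hcomp

/-- This is why a filter value that is frozen over a period does not affect the averaged gradient.
-/
theorem avgObj_sub_const {m : ℕ} {f : State m → ℝ} (hf : Continuous f) (a e : ℝ) :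
    avgObj (fun y => f y - e) a = fun x => avgObj f a x - e := by
  have hcomp := isCompact_closedBall (0 : State m) (1 : ℝ)
  have hv := volume_real_closedBall_pos m
  ext x
  simp only [avgObj]
  rw [integral_sub]
  · rw [setIntegral_const, mul_sub, smul_eq_mul, ← mul_assoc, inv_mul_cancel₀ hv.ne', one_mul]
  · exact Continuous.continuousOn (by fun_prop) |>.integrableOn_compact hcomp
  · exact continuousOn_const.integrableOn_compact hcomp

/-- Functions bounded by one that are Lipschitz continuous. -/
def UnitLipschitz {X : Type*} [PseudoMetricSpace X] (u : X → ℝ) : Prop :=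
  (∃ L, LipschitzWith L u) ∧ ∀ x, |u x| ≤ 1

theorem lipschitzWith_mul {X : Type*} [PseudoMetricSpace X] {u v : X → ℝ} {A B Lu Lv : NNReal}
    (hu : LipschitzWith Lu u) (hA : ∀ x, |u x| ≤ A) (hv : LipschitzWith Lv v)
    (hB : ∀ x, |v x| ≤ B) : LipschitzWith (A * Lv + B * Lu) (fun x => u x * v x) := by
  refine LipschitzWith.of_dist_le_mul fun x y => ?_
  have h1 := hu.dist_le_mul x y
  have h2 := hv.dist_le_mul x y
  rw [Real.dist_eq] at *
  have h3 : u x * v x - u y * v y = u x * (v x - v y) + v y * (u x - u y) := by ring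
  rw [h3]
  push_cast
  calc _ ≤ |u x| * |v x - v y| + |v y| * |u x - u y| := by
        refine (abs_add_le _ _).trans_eq ?_
        rw [abs_mul, abs_mul]
    _ ≤ A * (Lv * dist x y) + B * (Lu * dist x y) := by
        gcongr
        · exact hA x
        · exact hB y
    _ = _ := by ring

theorem UnitLipschitz.mul {X : Type*} [PseudoMetricSpace X] {u v : X → ℝ}
    (hu : UnitLipschitz u) (hv : UnitLipschitz v) : UnitLipschitz fun x => u x * v x := by
  obtain ⟨⟨Lu, hLu⟩, hu1⟩ := hu
  obtain ⟨⟨Lv, hLv⟩, hv1⟩ := hv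
  refine ⟨⟨_, lipschitzWith_mul (A := 1) (B := 1) hLu hu1 hLv hv1⟩, fun x => ?_⟩
  rw [abs_mul]
  exact mul_le_one₀ (hu1 x) (abs_nonneg _) (hv1 x)

theorem UnitLipschitz.one {X : Type*} [PseudoMetricSpace X] :
    UnitLipschitz fun _ : X => (1 : ℝ) := ⟨⟨0, LipschitzWith.const 1⟩, by simp⟩

theorem UnitLipschitz.prod {X ι : Type*} [PseudoMetricSpace X] {u : ι → X → ℝ} (s : Finset ι)
    (hu : ∀ i, UnitLipschitz (u i)) : UnitLipschitz fun x => ∏ i ∈ s, u i x := by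
  classical
  induction s using Finset.induction_on with
  | empty => simpa using UnitLipschitz.one
  | insert i s hi ih => simpa [Finset.prod_insert hi] using (hu i).mul ih

theorem UnitLipschitz.pow {X : Type*} [PseudoMetricSpace X] {u : X → ℝ}
    (hu : UnitLipschitz u) (n : ℕ) : UnitLipschitz fun x => u x ^ n := by
  simpa using UnitLipschitz.prod (Finset.range n) fun _ => hu

theorem UnitLipschitz.abs {X : Type*} [PseudoMetricSpace X] {u : X → ℝ}
    (hu : UnitLipschitz u) : UnitLipschitz fun x => |u x| := by
  obtain ⟨⟨L, hL⟩, h1⟩ := hu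
  refine ⟨⟨L, LipschitzWith.of_dist_le_mul fun x y => ?_⟩, by simpa using h1⟩
  refine le_trans ?_ (hL.dist_le_mul x y)
  rw [Real.dist_eq, Real.dist_eq]
  exact abs_abs_sub_abs_le_abs_sub _ _

theorem unitLipschitz_sin {n : ℕ} (l : Fin n) : UnitLipschitz fun θ : Fin n → ℝ => Real.sin (θ l) :=
  ⟨⟨1 * 1, Real.lipschitzWith_sin.comp (LipschitzWith.eval l)⟩, fun _ => Real.abs_sin_le_one _⟩

theorem unitLipschitz_cos {n : ℕ} (l : Fin n) : UnitLipschitz fun θ : Fin n → ℝ => Real.cos (θ l) :=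
  ⟨⟨1 * 1, Real.lipschitzWith_cos.comp (LipschitzWith.eval l)⟩, fun _ => Real.abs_cos_le_one _⟩

theorem exists_lipschitzWith_gramWeight (m : ℕ) : ∃ L, LipschitzWith L (gramWeight m) :=
  (UnitLipschitz.abs (UnitLipschitz.prod Finset.univ fun l => (unitLipschitz_sin l).pow _)).1

theorem exists_lipschitzWith_sphCoord (m : ℕ) : ∃ L, LipschitzWith L (sphCoord m) := by
  have h : ∀ i : Fin (m + 2), ∃ L, LipschitzWith L fun θ => (sphCoord m θ).ofLp i := fun i => by
    induction i using Fin.cases with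
    | zero =>
      exact ((unitLipschitz_cos 0).mul (UnitLipschitz.prod _ fun l => unitLipschitz_sin l)).1
    | succ i =>
      refine (UnitLipschitz.mul ?_ (UnitLipschitz.prod _ fun l => unitLipschitz_sin l)).1
      split_ifs
      · exact unitLipschitz_sin i
      · exact unitLipschitz_cos i
  choose L hL using h
  have h2 : LipschitzWith (Finset.univ.sup L) fun θ => (sphCoord m θ).ofLp :=
    LipschitzWith.of_dist_le_mul fun θ θ' => by
      rw [dist_pi_le_iff (by positivity)]
      intro i
      refine ((hL i).dist_le_mul θ θ').trans ?_
      gcongr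
      exact Finset.le_sup (Finset.mem_univ i)
  exact ⟨_, (PiLp.lipschitzWith_toLp 2 _).comp h2⟩

theorem sphCoord_add_int_mul_two_pi {m : ℕ} (θ : Fin (m + 1) → ℝ) (z : Fin (m + 1) → ℤ) :
    sphCoord m (fun i => θ i + z i * (2 * Real.pi)) = sphCoord m θ := by
  simp only [sphCoord, Real.sin_add_int_mul_two_pi, Real.cos_add_int_mul_two_pi]

theorem gramWeight_add_int_mul_two_pi {m : ℕ} (θ : Fin (m + 1) → ℝ) (z : Fin (m + 1) → ℤ) :
    gramWeight m (fun i => θ i + z i * (2 * Real.pi)) = gramWeight m θ := by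
  simp only [gramWeight, Real.sin_add_int_mul_two_pi]

/-- The frequencies of the angle curve. -/
def angleFreq (m k : ℕ) (i : Fin (m + 1)) : ℕ := if i = 0 then 1 else 2 ^ ((i : ℕ) * k - 1)

/-- For k ≥ 1 the factors 2^(ik)/2 with i ≥ 1 are integers, so curve and dither have period 2π. -/
theorem angleCurve_eq {m k : ℕ} (hk : 1 ≤ k) (τ : ℝ) :
    angleCurve m k τ = fun i => (angleFreq m k i : ℝ) * τ := by
  ext i
  unfold angleCurve angleFreq
  split_ifs with h
  · simp
  · have h1 : 1 ≤ (i : ℕ) * k :=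
      Nat.one_le_iff_ne_zero.2 (mul_ne_zero (fun h0 => h (Fin.ext h0)) (by omega))
    push_cast
    rw [pow_sub₀ _ two_ne_zero h1]
    ring

/-- The worst ratio is that of the first two frequencies, 1 to 2^(k-1); it explains the factor 2.
Later consecutive ratios are 2^(-k). -/
theorem angleFreq_le {m k : ℕ} (hk : 1 ≤ k) (i j : Fin (m + 1)) (hij : i < j) :
    (angleFreq m k i : ℝ) ≤ (2 * (1 / 2) ^ k) * angleFreq m k j := by
  have hj : j ≠ 0 := by rintro rfl; exact absurd hij (Fin.not_lt_zero i)
  have hij' : (i : ℕ) + 1 ≤ j := hij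
  have h2 : (i : ℕ) * k + k ≤ j * k := by nlinarith
  have h3 : (2 * (1 / 2) ^ k : ℝ) * angleFreq m k j = 2 ^ ((j : ℕ) * k - k) := by
    simp only [angleFreq, hj, if_false]
    push_cast
    rw [pow_sub₀ _ two_ne_zero (by omega), pow_sub₀ _ two_ne_zero (by omega), one_div, inv_pow]
    ring
  rw [h3]
  unfold angleFreq
  split_ifs with h
  · simpa using one_le_pow₀ (one_le_two (α := ℝ))
  · push_cast
    exact pow_le_pow_right₀ one_le_two (by omega)

/-- The gain of the averaged gradient flow. -/
def avgGain (m : ℕ) (a : ℝ) : ℝ :=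
  (2 * Real.pi)⁻¹ ^ (m + 1) * (2 ^ m * a * volume.real (Metric.closedBall (0 : State m) 1))

theorem avgGain_pos (m : ℕ) {a : ℝ} (ha : 0 < a) : 0 < avgGain m a := by
  have := volume_real_closedBall_pos m
  have := Real.pi_pos
  unfold avgGain
  positivity

/-- Averaging the `x`-dynamics over one period of the dither gives the gradient of the averaged
objective, up to an error that vanishes as `k → ∞`. -/
theorem exists_average_dither_error {m : ℕ} {f : State m → ℝ} {C : NNReal} {M : ℝ}
    (hf : ContDiff ℝ 1 f) (hC : LipschitzWith C f) (hM : ∀ x, |f x| ≤ M) {a : ℝ} (ha : 0 < a)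
    (ρ : ℝ) : ∃ A : ℝ, 0 ≤ A ∧ ∀ (k : ℕ) (x p : State m) (e : ℝ), 1 ≤ k → |e| ≤ ρ →
      |(2 * Real.pi)⁻¹ * (∫ τ in (-Real.pi)..Real.pi,
          (f (x + a • curveU m k τ) - e) * inner ℝ (ditherV m k τ) p) -
        avgGain m a * inner ℝ (gradient (avgObj f a) x) p| ≤ A * (1 / 2) ^ k * ‖p‖ := by
  obtain ⟨Lg, hLg⟩ := exists_lipschitzWith_gramWeight m
  obtain ⟨Ls, hLs⟩ := exists_lipschitzWith_sphCoord m
  let aN : NNReal := ⟨a, ha.le⟩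
  let MN : NNReal := (M + ρ).toNNReal
  -- The product rule gives the torus integrand the Lipschitz constant K‖p‖, uniformly in x, in |e|
  -- ≤ ρ and in k. With the frequency ratio 2·2^(-k) the averaging lemma then yields the constant of
  -- the next line.
  let K : NNReal := 1 * (MN * Ls + 1 * (C * (aN * Ls))) + MN * Lg
  refine ⟨(m + 1) * (K * (2 * Real.pi)), by positivity, fun k x p e hk he => ?_⟩
  let pN : NNReal := ‖p‖₊
  let F : (Fin (m + 1) → ℝ) → ℝ := fun θ =>
    gramWeight m θ * ((f (x + a • sphCoord m θ) - e) * inner ℝ (sphCoord m θ) p)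
  have hMρ : ∀ y, |f y - e| ≤ MN := fun y => by
    refine le_trans ?_ (Real.le_coe_toNNReal _)
    exact (abs_sub _ _).trans (add_le_add (hM y) he)
  have h1 : LipschitzWith (C * (aN * Ls)) fun θ => f (x + a • sphCoord m θ) - e := by
    refine LipschitzWith.of_dist_le_mul fun θ θ' => ?_
    rw [dist_sub_right]
    refine (hC.dist_le_mul _ _).trans ?_
    rw [dist_add_left, dist_smul₀, Real.norm_eq_abs, abs_of_pos ha]
    push_cast
    rw [mul_assoc, mul_assoc]
    have := hLs.dist_le_mul θ θ'
    have haN : (aN : ℝ) = a := rfl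
    rw [haN]
    gcongr
  have h2 : LipschitzWith (pN * Ls) fun θ => inner ℝ (sphCoord m θ) p := by
    refine LipschitzWith.of_dist_le_mul fun θ θ' => ?_
    rw [Real.dist_eq, ← inner_sub_left]
    refine (abs_real_inner_le_norm _ _).trans ?_
    have := hLs.dist_le_mul θ θ'
    rw [dist_eq_norm] at this
    calc _ ≤ (Ls * dist θ θ') * ‖p‖ := by gcongr
      _ = _ := by simp [pN]; ring
  have h2b : ∀ θ, |inner ℝ (sphCoord m θ) p| ≤ pN := fun θ => by
    simpa [norm_sphCoord, pN] using abs_real_inner_le_norm (sphCoord m θ) p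
  have h3 := lipschitzWith_mul h1 (fun θ => hMρ _) h2 h2b
  have h4 : LipschitzWith (1 * (MN * (pN * Ls) + pN * (C * (aN * Ls))) + (MN * pN) * Lg) F := by
    refine lipschitzWith_mul (A := 1) hLg (fun θ => ?_) h3 (fun θ => ?_)
    · rw [abs_of_nonneg (gramWeight_nonneg θ)]; exact gramWeight_le_one θ
    · rw [abs_mul]
      push_cast
      exact mul_le_mul (hMρ _) (h2b θ) (abs_nonneg _) MN.2
  have h5 : (1 * (MN * (pN * Ls) + pN * (C * (aN * Ls))) + (MN * pN) * Lg) = K * pN := by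
    simp only [K]; ring
  rw [h5] at h4
  have hper : ∀ (θ : Fin (m + 1) → ℝ) (z : Fin (m + 1) → ℤ),
      F (fun i => θ i + z i * (2 * Real.pi)) = F θ := fun θ z => by
    simp only [F]
    rw [sphCoord_add_int_mul_two_pi, gramWeight_add_int_mul_two_pi]
  have h6 := abs_curve_average_sub_torus_average_le (q := 2 * (1 / 2) ^ k) (by positivity) (m + 1)
    (angleFreq m k) F (K * pN) (fun i => by unfold angleFreq; split_ifs <;> positivity)
    (angleFreq_le hk) h4 hper
  have hdiff : DifferentiableAt ℝ (avgObj f a) x := (hasFDerivAt_avgObj hf hC a x).differentiableAt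
  have hgrad : gradient (avgObj (fun y => f y - e) a) x = gradient (avgObj f a) x := by
    rw [avgObj_sub_const hf.continuous]
    unfold gradient
    rw [fderiv_sub_const]
  have h7 := integral_torus_eq_inner_gradient_avgObj (f := fun y => f y - e)
    (hf.continuous.sub continuous_const) a x p (by
      rw [avgObj_sub_const hf.continuous]; exact hdiff.sub_const e)
  rw [hgrad] at h7
  have h8 : ∀ τ, (f (x + a • curveU m k τ) - e) * inner ℝ (ditherV m k τ) p =
      F (fun i => angleFreq m k i * τ) := fun τ => by
    simp only [F, ditherV, curveU, ← angleCurve_eq hk τ, inner_smul_left]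
    simp only [conj_trivial]
    ring
  simp only [h8]
  have h9 : ∫ θ, F θ ∂(torusMeasure (m + 1)) =
      2 ^ m * a * volume.real (Metric.closedBall (0 : State m) 1) *
        inner ℝ (gradient (avgObj f a) x) p := h7
  rw [h9, ← mul_assoc] at h6
  refine h6.trans_eq ?_
  push_cast
  simp only [pN, coe_nnnorm]
  ring

theorem norm_curveU (m k : ℕ) (τ : ℝ) : ‖curveU m k τ‖ = 1 := norm_sphCoord _

theorem norm_ditherV_le (m k : ℕ) (τ : ℝ) : ‖ditherV m k τ‖ ≤ 1 := by
  unfold ditherV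
  rw [norm_smul, norm_curveU, mul_one, Real.norm_eq_abs, abs_of_nonneg (gramWeight_nonneg _)]
  exact gramWeight_le_one _

@[fun_prop]
theorem continuous_angleCurve (m k : ℕ) : Continuous (angleCurve m k) := by
  refine continuous_pi fun i => ?_
  unfold angleCurve
  split_ifs <;> fun_prop

@[fun_prop]
theorem continuous_curveU (m k : ℕ) : Continuous (curveU m k) :=
  (continuous_sphCoord m).comp (continuous_angleCurve m k)

@[fun_prop]
theorem continuous_ditherV (m k : ℕ) : Continuous (ditherV m k) :=
  ((continuous_gramWeight m).comp (continuous_angleCurve m k)).smul (continuous_curveU m k)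

theorem curveU_add_two_pi {m k : ℕ} (hk : 1 ≤ k) (τ : ℝ) :
    curveU m k (τ + 2 * Real.pi) = curveU m k τ := by
  simp only [curveU, angleCurve_eq hk]
  rw [← sphCoord_add_int_mul_two_pi (fun i => (angleFreq m k i : ℝ) * τ)
    (fun i => (angleFreq m k i : ℤ))]
  congr 1
  ext i
  push_cast
  ring

theorem ditherV_add_two_pi {m k : ℕ} (hk : 1 ≤ k) (τ : ℝ) :
    ditherV m k (τ + 2 * Real.pi) = ditherV m k τ := by
  simp only [ditherV, curveU_add_two_pi hk, angleCurve_eq hk]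
  rw [← gramWeight_add_int_mul_two_pi (fun i => (angleFreq m k i : ℝ) * τ)
    (fun i => (angleFreq m k i : ℤ))]
  congr 2
  ext i
  push_cast
  ring

/-- A smooth function agrees on a given ball with one that is bounded and Lipschitz, with Lipschitz
derivative. -/
theorem exists_truncation {m : ℕ} {J : State m → ℝ}
    (hJ : ContDiff ℝ ((⊤ : ℕ∞) : WithTop ℕ∞) J) (R : ℝ) :
    ∃ (f : State m → ℝ) (M : ℝ) (C L : NNReal), (∀ x, ‖x‖ ≤ R → f x = J x) ∧ ContDiff ℝ 1 f ∧
      LipschitzWith C f ∧ LipschitzWith L (fderiv ℝ f) ∧ 0 ≤ M ∧ ∀ x, |f x| ≤ M := by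
  have hR : 0 < max R 0 + 1 := by positivity
  let χ : ContDiffBump (0 : State m) := ⟨max R 0 + 1, max R 0 + 2, hR, by linarith⟩
  have hχ : ContDiff ℝ ((⊤ : ℕ∞) : WithTop ℕ∞) χ := χ.contDiff
  let f : State m → ℝ := fun x => χ x * J x
  have hf : ContDiff ℝ ((⊤ : ℕ∞) : WithTop ℕ∞) f := hχ.mul hJ
  have hs : HasCompactSupport f := χ.hasCompactSupport.mul_right
  obtain ⟨M, hM⟩ := hs.exists_bound_of_continuous hf.continuous
  have hf1 : ContDiff ℝ 1 f := hf.of_le (by exact_mod_cast le_top)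
  have hf' : ContDiff ℝ 1 (fderiv ℝ f) := (contDiff_infty.1 hf 2).fderiv_right (by
    rw [one_add_one_eq_two]; rfl)
  obtain ⟨C, hC⟩ := hf1.lipschitzWith_of_hasCompactSupport hs one_ne_zero
  obtain ⟨L, hL⟩ := hf'.lipschitzWith_of_hasCompactSupport (hs.fderiv ℝ) one_ne_zero
  refine ⟨f, M, C, L, fun x hx => ?_, hf1, hC, hL, (norm_nonneg _).trans (hM 0), hM⟩
  have : χ x = 1 := χ.one_of_mem_closedBall (by
    rw [mem_closedBall_zero_iff]
    exact hx.trans ((le_max_left R 0).trans (by simp [χ])))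
  simp [f, this]

theorem avgObj_congr {m : ℕ} {f J : State m → ℝ} {R a : ℝ} (ha : 0 < a)
    (hfJ : ∀ x, ‖x‖ ≤ R → f x = J x) {x : State m} (hx : ‖x‖ + a ≤ R) :
    avgObj f a x = avgObj J a x := by
  unfold avgObj
  congr 1
  refine setIntegral_congr_fun measurableSet_closedBall fun ξ hξ => ?_
  refine hfJ _ ((norm_add_le _ _).trans (le_trans ?_ hx))
  rw [mem_closedBall_zero_iff] at hξ
  rw [norm_smul, Real.norm_eq_abs, abs_of_pos ha]
  gcongr
  exact mul_le_of_le_one_right ha.le hξ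

/-- The strict inequality makes the two averages agree on a neighbourhood, not only at the point. -/
theorem gradient_avgObj_congr {m : ℕ} {f J : State m → ℝ} {R a : ℝ} (ha : 0 < a)
    (hfJ : ∀ x, ‖x‖ ≤ R → f x = J x) {x : State m} (hx : ‖x‖ + a < R) :
    gradient (avgObj f a) x = gradient (avgObj J a) x := by
  have h : avgObj f a =ᶠ[𝓝 x] avgObj J a := by
    have : ∀ᶠ y in 𝓝 x, ‖y‖ + a < R :=
      (continuous_norm.add continuous_const).continuousAt.eventually_lt continuousAt_const hx
    filter_upwards [this] with y hy using avgObj_congr ha hfJ hy.le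
  unfold gradient
  rw [h.fderiv_eq]

end ExtremumSeeking

end

/-! ### Global solutions for a bounded Lipschitz objective -/

noncomputable section

namespace ExtremumSeeking

theorem rhsX_eq {m : ℕ} (J : State m → ℝ) (a b ω : ℝ) (k : ℕ) (dt t : ℝ) (x : State m) (η : ℝ) :
    rhsX J a b ω k dt t x η = (b * (J (x + a • curveU m k (ω * t)) - η + dt)) •
      ditherV m k (ω * t) := by
  unfold rhsX
  module

theorem norm_rhsX_le {m : ℕ} {J : State m → ℝ} {M ρ D a b ω dt t η : ℝ} {k : ℕ} {x : State m}
    (hb : 0 ≤ b) (hM : ∀ x, |J x| ≤ M) (hη : |η| ≤ ρ) (hd : |dt| ≤ D) :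
    ‖rhsX J a b ω k dt t x η‖ ≤ b * (M + ρ + D) := by
  rw [rhsX_eq, norm_smul, Real.norm_eq_abs, abs_mul, abs_of_nonneg hb]
  have h1 := hM (x + a • curveU m k (ω * t))
  have h2 : |J (x + a • curveU m k (ω * t)) - η + dt| ≤ M + ρ + D :=
    (abs_add_le _ _).trans (add_le_add ((abs_sub _ _).trans (add_le_add h1 hη)) hd)
  calc _ ≤ b * (M + ρ + D) * 1 := by
        gcongr
        · exact mul_nonneg hb ((abs_nonneg _).trans h2)
        · exact norm_ditherV_le _ _ _
    _ = _ := mul_one _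

/-- A continuous function that cannot grow while it exceeds the level `ρ` stays below `ρ`. -/
theorem le_of_nonincreasing_above {η : ℝ → ℝ} {t₀ t₁ ρ : ℝ} (hc : ContinuousOn η (Icc t₀ t₁))
    (h0 : η t₀ ≤ ρ)
    (hdec : ∀ s t, t₀ ≤ s → s ≤ t → t ≤ t₁ → (∀ r ∈ Ioc s t, ρ ≤ η r) → η t ≤ η s) :
    ∀ t ∈ Icc t₀ t₁, η t ≤ ρ := by
  intro t ht
  by_contra hcon
  have hcomp : IsCompact (Icc t₀ t ∩ η ⁻¹' Iic ρ) :=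
    isCompact_Icc.of_isClosed_subset
      ((hc.mono (Icc_subset_Icc_right ht.2)).preimage_isClosed_of_isClosed isClosed_Icc isClosed_Iic)
      inter_subset_left
  obtain ⟨s, hs, hmax⟩ := hcomp.exists_isGreatest ⟨t₀, ⟨le_rfl, ht.1⟩, h0⟩
  have h := hdec s t hs.1.1 hs.1.2 ht.2 fun r hr => by
    by_contra h
    exact absurd (hmax ⟨⟨hs.1.1.trans hr.1.le, hr.2⟩, (not_le.1 h).le⟩) (not_le.2 hr.1)
  exact hcon (h.trans hs.2)

theorem lipschitzWith_clamp (ρ : ℝ) : LipschitzWith 1 fun y : ℝ => max (-ρ) (min y ρ) :=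
  (LipschitzWith.id.min_const ρ).const_max (-ρ)

theorem abs_clamp_le {ρ : ℝ} (hρ : 0 ≤ ρ) (y : ℝ) : |max (-ρ) (min y ρ)| ≤ ρ :=
  abs_le.2 ⟨le_max_left _ _, max_le (by linarith) (min_le_right _ _)⟩

/-- Outside [-ρ, ρ] the clamped state equals ±ρ, and an input bounded by ρ cannot push it further
out. So the clamp never becomes active along a solution. -/
theorem abs_le_of_filter_eq {η u : ℝ → ℝ} {t₀ t₁ ρ h η₀ : ℝ} (hρ : 0 ≤ ρ) (hh : 0 ≤ h)
    (hc : ContinuousOn η (Icc t₀ t₁)) (hη₀ : |η₀| ≤ ρ) (hu : ∀ᵐ s, |u s| ≤ ρ)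
    (hint : ∀ t ∈ Icc t₀ t₁, IntervalIntegrable
      (fun s => -h * max (-ρ) (min (η s) ρ) + h * u s) volume t₀ t)
    (heq : ∀ t ∈ Icc t₀ t₁, η t = η₀ + ∫ s in t₀..t, (-h * max (-ρ) (min (η s) ρ) + h * u s)) :
    ∀ t ∈ Icc t₀ t₁, |η t| ≤ ρ := by
  have hdiff : ∀ s t, t₀ ≤ s → s ≤ t → t ≤ t₁ →
      η t - η s = ∫ r in s..t, (-h * max (-ρ) (min (η r) ρ) + h * u r) := fun s t h1 h2 h3 => by
    rw [heq t ⟨h1.trans h2, h3⟩, heq s ⟨h1, h2.trans h3⟩,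
      ← intervalIntegral.integral_interval_sub_left (hint t ⟨h1.trans h2, h3⟩)
        (hint s ⟨h1, h2.trans h3⟩)]
    ring
  have h00 : ∀ t, t ∈ Icc t₀ t₁ → η t₀ = η₀ := fun t ht => by
    simpa using heq t₀ ⟨le_rfl, ht.1.trans ht.2⟩
  have habs := abs_le.1 hη₀
  intro t ht
  rw [abs_le]
  constructor
  · have := le_of_nonincreasing_above (η := fun s => -η s) (ρ := ρ) hc.neg
      (by rw [h00 t ht]; linarith [habs.1]) (fun s r h1 h2 h3 hge => by
        rw [neg_le_neg_iff, ← sub_nonneg, hdiff s r h1 h2 h3,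
          intervalIntegral.integral_of_le h2]
        refine integral_nonneg_of_ae ?_
        filter_upwards [ae_restrict_mem measurableSet_Ioc, ae_restrict_of_ae hu] with q hq huq
        have h5 := hge q hq
        have h6 : max (-ρ) (min (η q) ρ) = -ρ :=
          max_eq_left ((min_le_left _ _).trans (by linarith))
        have h7 := (abs_le.1 huq).1
        simp only [Pi.zero_apply, h6]
        nlinarith) t ht
    linarith
  · refine le_of_nonincreasing_above hc (by rw [h00 t ht]; exact habs.2)
      (fun s r h1 h2 h3 hge => ?_) t ht
    rw [← sub_nonpos, hdiff s r h1 h2 h3, intervalIntegral.integral_of_le h2]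
    refine integral_nonpos_of_ae ?_
    filter_upwards [ae_restrict_mem measurableSet_Ioc, ae_restrict_of_ae hu] with q hq huq
    have h6 : max (-ρ) (min (η q) ρ) = ρ := by
      rw [min_eq_right (hge q hq)]; exact max_eq_right (by linarith)
    have h7 := (abs_le.1 huq).2
    simp only [Pi.zero_apply, h6]
    nlinarith

/-- Global existence for a continuous, bounded, Lipschitz vector field with an additive locally
integrable forcing term. -/
theorem exists_integral_solution {E : Type*} [NormedAddCommGroup E] [NormedSpace ℝ E]
    [CompleteSpace E] {v : ℝ → E → E} {w : ℝ → E} {K L : NNReal}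
    (hv : Continuous (Function.uncurry v)) (hK : ∀ t, LipschitzWith K (v t))
    (hL : ∀ t p, ‖v t p‖ ≤ L) (hw : ∀ s t, IntervalIntegrable w volume s t) {t₀ t₁ : ℝ}
    (h01 : t₀ ≤ t₁) (p₀ : E) :
    ∃ α : ℝ → E, ContinuousOn α (Icc t₀ t₁) ∧
      (∀ t ∈ Icc t₀ t₁, IntervalIntegrable (fun s => v s (α s) + w s) volume t₀ t) ∧
      ∀ t ∈ Icc t₀ t₁, α t = p₀ + ∫ s in t₀..t, (v s (α s) + w s) := by
  -- Subtracting the primitive of the forcing leaves an equation with continuous right-hand side, to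
  -- which Picard-Lindelöf applies although the forcing is merely integrable.
  let W : ℝ → E := fun t => ∫ s in t₀..t, w s
  have hWc : Continuous W := intervalIntegral.continuous_primitive hw t₀
  -- A solution of speed at most L cannot leave the ball of this radius before t₁, so a single
  -- application covers the whole interval.
  let A : NNReal := L * ⟨t₁ - t₀, sub_nonneg.2 h01⟩
  have hvW : Continuous (Function.uncurry fun t p => v t (p + W t)) := by
    simp only [Function.uncurry_def] at hv ⊢
    exact hv.comp (by fun_prop : Continuous fun x : ℝ × E => (x.1, x.2 + W x.1))
  have hPL : IsPicardLindelof (fun t p => v t (p + W t)) (tmin := t₀) (tmax := t₁)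
      ⟨t₀, le_rfl, h01⟩ p₀ A 0 L K := by
    refine ⟨fun t _ => LipschitzWith.lipschitzOnWith (LipschitzWith.of_dist_le_mul fun p q => ?_),
      fun p _ => ?_, fun t _ p _ => hL t _, ?_⟩
    · simpa using (hK t).dist_le_mul (p + W t) (q + W t)
    · exact (hvW.comp (by fun_prop : Continuous fun t => (t, p))).continuousOn
    · have hA : (A : ℝ) = L * (t₁ - t₀) := rfl
      simp [hA, h01]
  obtain ⟨α, hα0, hα⟩ := hPL.exists_eq_forall_mem_Icc_hasDerivWithinAt₀
  have hαc : ContinuousOn α (Icc t₀ t₁) := fun t ht => (hα t ht).continuousWithinAt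
  have hg : ContinuousOn (fun s => v s (α s + W s)) (Icc t₀ t₁) :=
    hvW.comp_continuousOn (continuousOn_id.prodMk hαc)
  have hgi : ∀ t ∈ Icc t₀ t₁, IntervalIntegrable (fun s => v s (α s + W s)) volume t₀ t :=
    fun t ht => (hg.mono (by
      rw [uIcc_of_le ht.1]; exact Icc_subset_Icc_right ht.2)).intervalIntegrable
  refine ⟨fun t => α t + W t, hαc.add hWc.continuousOn, fun t ht => (hgi t ht).add (hw _ _),
    fun t ht => ?_⟩
  rw [intervalIntegral.integral_add (hgi t ht) (hw _ _),
    intervalIntegral.integral_eq_sub_of_hasDerivAt_of_le ht.1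
      (hαc.mono (Icc_subset_Icc_right ht.2))
      (fun s hs => (hα s ⟨hs.1.le, hs.2.le.trans ht.2⟩).hasDerivAt
        (Icc_mem_nhds hs.1 (hs.2.trans_le ht.2))) (hgi t ht), hα0]
  simp only [W]
  abel

/-- The undisturbed vector field with the filter state clamped to `[-ρ, ρ]`. -/
def clampedField {m : ℕ} (f : State m → ℝ) (a b h ω : ℝ) (k : ℕ) (ρ t : ℝ) (p : State m × ℝ) :
    State m × ℝ :=
  (rhsX f a b ω k 0 t p.1 (max (-ρ) (min p.2 ρ)), rhsEta f a h ω k 0 t p.1 (max (-ρ) (min p.2 ρ)))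

theorem continuous_clampedField {m : ℕ} {f : State m → ℝ} (hf : Continuous f) (a b h ω : ℝ)
    (k : ℕ) (ρ : ℝ) : Continuous (Function.uncurry (clampedField f a b h ω k ρ)) := by
  unfold clampedField rhsX rhsEta
  simp only [Function.uncurry_def]
  fun_prop

theorem lipschitzWith_clampedField {m : ℕ} {f : State m → ℝ} {C : NNReal}
    (hC : LipschitzWith C f) (a ω : ℝ) (k : ℕ) (ρ : ℝ) (b h : NNReal) (t : ℝ) :
    LipschitzWith (max (b * (C + 1)) (h * (C + 1))) (clampedField f a b h ω k ρ t) := by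
  have hd1 : ∀ p q : State m × ℝ, |f (p.1 + a • curveU m k (ω * t)) -
      f (q.1 + a • curveU m k (ω * t))| ≤ C * dist p q := fun p q => by
    rw [← Real.dist_eq]
    refine (hC.dist_le_mul _ _).trans ?_
    rw [dist_add_right]
    gcongr
    exact le_max_left _ _
  have hd2 : ∀ p q : State m × ℝ, |max (-ρ) (min p.2 ρ) - max (-ρ) (min q.2 ρ)| ≤ dist p q :=
    fun p q => by
    rw [← Real.dist_eq]
    refine ((lipschitzWith_clamp ρ).dist_le_mul _ _).trans ?_
    rw [NNReal.coe_one, one_mul]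
    exact le_max_right _ _
  refine LipschitzWith.prodMk (LipschitzWith.of_dist_le_mul fun p q => ?_)
    (LipschitzWith.of_dist_le_mul fun p q => ?_)
  · rw [rhsX_eq, rhsX_eq, dist_eq_norm, ← sub_smul, norm_smul, Real.norm_eq_abs, ← mul_sub,
      abs_mul, abs_of_nonneg b.coe_nonneg]
    have h1 := hd1 p q
    have h2 := hd2 p q
    have h3 := norm_ditherV_le m k (ω * t)
    push_cast
    calc _ ≤ (b : ℝ) * (C * dist p q + dist p q) * 1 := by
          gcongr
          refine le_trans (le_of_eq ?_) ((abs_sub _ _).trans (add_le_add h1 h2))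
          congr 1
          ring
      _ = _ := by ring
  · have h1 := hd1 p q
    have h2 := hd2 p q
    unfold rhsEta
    push_cast
    rw [Real.dist_eq]
    calc _ = |(h : ℝ)| * |(f (p.1 + a • curveU m k (ω * t)) -
            f (q.1 + a • curveU m k (ω * t))) -
            (max (-ρ) (min p.2 ρ) - max (-ρ) (min q.2 ρ))| := by
          rw [← abs_mul]
          congr 1
          ring
      _ ≤ h * (C * dist p q + dist p q) := by
          rw [abs_of_nonneg h.coe_nonneg]
          gcongr
          exact (abs_sub _ _).trans (add_le_add h1 h2)
      _ = _ := by ring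

/-- Boundedness is the purpose of the clamp: the field is affine in η, so it would be Lipschitz
without it, but not bounded. -/
theorem norm_clampedField_le {m : ℕ} {f : State m → ℝ} {M : ℝ} (hM : ∀ x, |f x| ≤ M)
    {a b h ω : ℝ} {k : ℕ} (hb : 0 ≤ b) (hh : 0 ≤ h) {ρ : ℝ} (hρ : 0 ≤ ρ) (t : ℝ)
    (p : State m × ℝ) : ‖clampedField f a b h ω k ρ t p‖ ≤ (b + h) * (M + ρ) := by
  have hM0 : 0 ≤ M := (abs_nonneg _).trans (hM 0)
  have hcl := abs_clamp_le hρ p.2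
  have h1 : ‖rhsX f a b ω k 0 t p.1 (max (-ρ) (min p.2 ρ))‖ ≤ b * (M + ρ + 0) :=
    norm_rhsX_le hb hM hcl (by simp)
  have h2 : ‖rhsEta f a h ω k 0 t p.1 (max (-ρ) (min p.2 ρ))‖ ≤ h * (M + ρ) := by
    have h4 := hM (p.1 + a • curveU m k (ω * t))
    simp only [rhsEta, Real.norm_eq_abs]
    calc _ = |h| * |f (p.1 + a • curveU m k (ω * t)) - max (-ρ) (min p.2 ρ)| := by
          rw [← abs_mul]; congr 1; ring
      _ ≤ h * (M + ρ) := by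
          rw [abs_of_nonneg hh]
          gcongr
          exact (abs_sub _ _).trans (add_le_add h4 hcl)
  have h3 : 0 ≤ M + ρ := by positivity
  rw [Prod.norm_def]
  exact max_le (h1.trans (by nlinarith)) (h2.trans (by nlinarith))

/-- Global existence of solutions for a bounded Lipschitz objective function. -/
theorem exists_isSolution_of_lipschitz {m : ℕ} {f : State m → ℝ} {C : NNReal} {M : ℝ}
    (hC : LipschitzWith C f) (hM : ∀ x, |f x| ≤ M) {a b h ω : ℝ} {k : ℕ} (hb : 0 < b) (hh : 0 < h)
    {d : ℝ → ℝ} (hdint : ∀ s t, IntervalIntegrable d volume s t) {D : ℝ}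
    (hD : ∀ᵐ s, |d s| ≤ D) {ρ : ℝ} (hMD : M + D ≤ ρ) {t₀ t₁ : ℝ} (h01 : t₀ ≤ t₁) (x₀ : State m)
    {η₀ : ℝ} (hη₀ : |η₀| ≤ ρ) :
    ∃ (x : ℝ → State m) (η : ℝ → ℝ),
      IsSolution f a b h ω k d t₀ x₀ η₀ (Icc t₀ t₁) x η ∧ ∀ t ∈ Icc t₀ t₁, |η t| ≤ ρ := by
  have hρ : 0 ≤ ρ := (abs_nonneg _).trans hη₀
  have hM0 : 0 ≤ M := (abs_nonneg _).trans (hM 0)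
  have hix : ∀ s t, IntervalIntegrable (fun s => d s • b • ditherV m k (ω * s)) volume s t :=
    fun s t => (hdint s t).smul_continuousOn (by fun_prop)
  have hie : ∀ s t, IntervalIntegrable (fun s => h * d s) volume s t :=
    fun s t => (hdint s t).const_mul h
  have hw : ∀ s t, IntervalIntegrable (fun s => (d s • b • ditherV m k (ω * s), h * d s))
      volume s t := fun s t =>
    ⟨(hix s t).1.prodMk (hie s t).1, (hix s t).2.prodMk (hie s t).2⟩
  obtain ⟨α, hαc, hαi, hα⟩ := exists_integral_solution
    (v := clampedField f a b h ω k ρ) (L := ⟨(b + h) * (M + ρ), by positivity⟩)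
    (continuous_clampedField hC.continuous a b h ω k ρ)
    (lipschitzWith_clampedField hC a ω k ρ ⟨b, hb.le⟩ ⟨h, hh.le⟩)
    (norm_clampedField_le hM hb.le hh.le hρ) hw h01 (x₀, η₀)
  let x : ℝ → State m := fun t => (α t).1
  let η : ℝ → ℝ := fun t => (α t).2
  have hsum : ∀ s, clampedField f a b h ω k ρ s (α s) +
      (d s • b • ditherV m k (ω * s), h * d s) =
      (rhsX f a b ω k (d s) s (x s) (max (-ρ) (min (η s) ρ)),
        rhsEta f a h ω k (d s) s (x s) (max (-ρ) (min (η s) ρ))) := fun s => by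
    simp [clampedField, x, η, rhsX, rhsEta]
  simp only [hsum] at hαi hα
  have hxint : ∀ t ∈ Icc t₀ t₁, IntervalIntegrable
      (fun s => rhsX f a b ω k (d s) s (x s) (max (-ρ) (min (η s) ρ))) volume t₀ t :=
    fun t ht => ⟨(hαi t ht).1.fst, (hαi t ht).2.fst⟩
  have heint : ∀ t ∈ Icc t₀ t₁, IntervalIntegrable
      (fun s => rhsEta f a h ω k (d s) s (x s) (max (-ρ) (min (η s) ρ))) volume t₀ t :=
    fun t ht => ⟨(hαi t ht).1.snd, (hαi t ht).2.snd⟩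
  have hxeq : ∀ t ∈ Icc t₀ t₁, x t =
      x₀ + ∫ s in t₀..t, rhsX f a b ω k (d s) s (x s) (max (-ρ) (min (η s) ρ)) := fun t ht => by
    have h2 := (ContinuousLinearMap.fst ℝ (State m) ℝ).intervalIntegral_comp_comm (hαi t ht)
    simp only [ContinuousLinearMap.coe_fst'] at h2
    rw [h2]
    exact congrArg Prod.fst (hα t ht)
  have heeq : ∀ t ∈ Icc t₀ t₁, η t =
      η₀ + ∫ s in t₀..t, rhsEta f a h ω k (d s) s (x s) (max (-ρ) (min (η s) ρ)) := fun t ht => by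
    have h2 := (ContinuousLinearMap.snd ℝ (State m) ℝ).intervalIntegral_comp_comm (hαi t ht)
    simp only [ContinuousLinearMap.coe_snd'] at h2
    rw [h2]
    exact congrArg Prod.snd (hα t ht)
  have hxc : ContinuousOn x (Icc t₀ t₁) := continuous_fst.comp_continuousOn hαc
  have hec : ContinuousOn η (Icc t₀ t₁) := continuous_snd.comp_continuousOn hαc
  have hfilter : ∀ s, rhsEta f a h ω k (d s) s (x s) (max (-ρ) (min (η s) ρ)) =
      -h * max (-ρ) (min (η s) ρ) + h * (f (x s + a • curveU m k (ω * s)) + d s) := fun s => by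
    simp only [rhsEta]; ring
  have hbound : ∀ t ∈ Icc t₀ t₁, |η t| ≤ ρ := by
    simp only [hfilter] at heint heeq
    refine abs_le_of_filter_eq hρ hh.le hec hη₀ ?_ heint heeq
    filter_upwards [hD] with s hs
    exact (abs_add_le _ _).trans ((add_le_add (hM _) hs).trans hMD)
  -- The a priori bound makes the clamp inert, so the clamped equation is the original one.
  have hcleq : ∀ t ∈ Icc t₀ t₁, max (-ρ) (min (η t) ρ) = η t := fun t ht => by
    have := abs_le.1 (hbound t ht)
    rw [min_eq_left this.2, max_eq_right this.1]
  have hsub : ∀ t ∈ Icc t₀ t₁, uIcc t₀ t ⊆ Icc t₀ t₁ := fun t ht => by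
    rw [uIcc_of_le ht.1]; exact Icc_subset_Icc_right ht.2
  refine ⟨x, η, ⟨⟨le_rfl, h01⟩, ordConnected_Icc, hxc, hec, fun t ht => ?_, fun t ht => ?_,
    fun t ht => ?_, fun t ht => ?_⟩, hbound⟩
  · refine (hxint t ht).congr fun s hs => ?_
    simp only [hcleq s (hsub t ht (uIoc_subset_uIcc hs))]
  · refine (heint t ht).congr fun s hs => ?_
    simp only [hcleq s (hsub t ht (uIoc_subset_uIcc hs))]
  · rw [hxeq t ht]
    congr 1
    refine intervalIntegral.integral_congr fun s hs => ?_
    simp only [hcleq s (hsub t ht hs)]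
  · rw [heeq t ht]
    congr 1
    refine intervalIntegral.integral_congr fun s hs => ?_
    simp only [hcleq s (hsub t ht hs)]

end ExtremumSeeking

end

/-! ### The dissipation inequality over one dither period -/

noncomputable section

namespace ExtremumSeeking

theorem norm_gradient_avgObj_le {m : ℕ} {f : State m → ℝ} {C : NNReal} (hf : ContDiff ℝ 1 f)
    (hC : LipschitzWith C f) (a : ℝ) (x : State m) : ‖gradient (avgObj f a) x‖ ≤ C := by
  have hv := volume_real_closedBall_pos m
  unfold gradient
  rw [LinearIsometryEquiv.norm_map, (hasFDerivAt_avgObj hf hC a x).fderiv, norm_smul,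
    Real.norm_eq_abs, abs_of_pos (by positivity), inv_mul_le_iff₀ hv, mul_comm]
  exact norm_setIntegral_le_of_norm_le_const measure_closedBall_lt_top
    fun ξ _ => norm_fderiv_le_of_lipschitz ℝ hC

theorem abs_avgObj_sub_le {m : ℕ} {f : State m → ℝ} {C : NNReal} (hf : ContDiff ℝ 1 f)
    (hC : LipschitzWith C f) (a : ℝ) (x y : State m) :
    |avgObj f a x - avgObj f a y| ≤ C * ‖x - y‖ := by
  have h := convex_univ.norm_image_sub_le_of_norm_fderiv_le (𝕜 := ℝ) (f := avgObj f a) (C := C)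
    (x := y) (y := x) (fun z _ => (hasFDerivAt_avgObj hf hC a z).differentiableAt)
    (fun z _ => ?_) trivial trivial
  · exact h
  · have := norm_gradient_avgObj_le hf hC a z
    unfold gradient at this
    rwa [LinearIsometryEquiv.norm_map] at this

/-- Mean value inequality on the ball of radius ‖y - x‖ about x, where the gradient varies by at
most L‖y - x‖; the sharp factor 1/2 is not needed. -/
theorem avgObj_sub_sub_inner_le {m : ℕ} {f : State m → ℝ} {C L : NNReal} (hf : ContDiff ℝ 1 f)
    (hC : LipschitzWith C f) (hL : LipschitzWith L (fderiv ℝ f)) (a : ℝ) (x y : State m) :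
    |avgObj f a y - avgObj f a x - inner ℝ (gradient (avgObj f a) x) (y - x)| ≤
      L * ‖y - x‖ * ‖y - x‖ := by
  have hg := lipschitzWith_gradient_avgObj hf hC hL a
  have h := (convex_closedBall x ‖y - x‖).norm_image_sub_le_of_norm_fderiv_le' (𝕜 := ℝ)
    (f := avgObj f a) (φ := fderiv ℝ (avgObj f a) x) (C := L * ‖y - x‖) (x := x) (y := y)
    (fun z _ => (hasFDerivAt_avgObj hf hC a z).differentiableAt)
    (fun z hz => ?_) (by simp) (by simp [dist_eq_norm])
  · rw [inner_gradient_left]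
    exact h
  · have h1 := hg.dist_le_mul z x
    unfold gradient at h1
    rw [LinearIsometryEquiv.dist_map, dist_eq_norm] at h1
    refine h1.trans ?_
    gcongr
    exact hz

variable {m : ℕ} {f : State m → ℝ} {a b h ω : ℝ} {k : ℕ} {d : ℝ → ℝ} {t₀ : ℝ} {x₀ : State m}
  {η₀ : ℝ} {I : Set ℝ} {x : ℝ → State m} {η : ℝ → ℝ}

theorem IsSolution.intervalIntegrable_x (hs : IsSolution f a b h ω k d t₀ x₀ η₀ I x η) {s t : ℝ}
    (hsI : s ∈ I) (htI : t ∈ I) :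
    IntervalIntegrable (fun r => rhsX f a b ω k (d r) r (x r) (η r)) volume s t :=
  (hs.integrable_x s hsI).symm.trans (hs.integrable_x t htI)

theorem IsSolution.x_sub (hs : IsSolution f a b h ω k d t₀ x₀ η₀ I x η) {s t : ℝ}
    (hsI : s ∈ I) (htI : t ∈ I) :
    x t - x s = ∫ r in s..t, rhsX f a b ω k (d r) r (x r) (η r) := by
  rw [hs.eq_x t htI, hs.eq_x s hsI, ← intervalIntegral.integral_interval_sub_left
    (hs.integrable_x t htI) (hs.integrable_x s hsI)]
  abel

theorem IsSolution.eta_sub (hs : IsSolution f a b h ω k d t₀ x₀ η₀ I x η) {s t : ℝ}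
    (hsI : s ∈ I) (htI : t ∈ I) :
    η t - η s = ∫ r in s..t, rhsEta f a h ω k (d r) r (x r) (η r) := by
  rw [hs.eq_eta t htI, hs.eq_eta s hsI, ← intervalIntegral.integral_interval_sub_left
    (hs.integrable_eta t htI) (hs.integrable_eta s hsI)]
  abel

theorem norm_integral_le_of_ae_le {E : Type*} [NormedAddCommGroup E] [NormedSpace ℝ E]
    {g : ℝ → E} {B s t : ℝ} (hst : s ≤ t) (hg : ∀ᵐ r, r ∈ Ioc s t → ‖g r‖ ≤ B) :
    ‖∫ r in s..t, g r‖ ≤ B * (t - s) := by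
  have := intervalIntegral.norm_integral_le_of_norm_le_const_ae (a := s) (b := t) (f := g) (C := B)
    (by rw [uIoc_of_le hst]; exact hg)
  rwa [abs_of_nonneg (sub_nonneg.2 hst)] at this

theorem IsSolution.norm_x_sub_le (hs : IsSolution f a b h ω k d t₀ x₀ η₀ I x η) (hb : 0 ≤ b)
    {M ρ D : ℝ} (hM : ∀ x, |f x| ≤ M) (hη : ∀ t ∈ I, |η t| ≤ ρ) (hD : ∀ᵐ s, |d s| ≤ D)
    {s t : ℝ} (hsI : s ∈ I) (htI : t ∈ I) (hst : s ≤ t) :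
    ‖x t - x s‖ ≤ b * (M + ρ + D) * (t - s) := by
  rw [hs.x_sub hsI htI]
  refine norm_integral_le_of_ae_le hst ?_
  filter_upwards [hD] with r hr hrI
  exact norm_rhsX_le hb hM (hη r (hs.ordConnected.out hsI htI ⟨hrI.1.le, hrI.2⟩)) hr

theorem IsSolution.abs_eta_sub_le (hs : IsSolution f a b h ω k d t₀ x₀ η₀ I x η) (hh : 0 ≤ h)
    {M ρ D : ℝ} (hM : ∀ x, |f x| ≤ M) (hη : ∀ t ∈ I, |η t| ≤ ρ) (hD : ∀ᵐ s, |d s| ≤ D)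
    {s t : ℝ} (hsI : s ∈ I) (htI : t ∈ I) (hst : s ≤ t) :
    |η t - η s| ≤ h * (M + ρ + D) * (t - s) := by
  rw [hs.eta_sub hsI htI, ← Real.norm_eq_abs]
  refine norm_integral_le_of_ae_le hst ?_
  filter_upwards [hD] with r hr hrI
  have h1 := hη r (hs.ordConnected.out hsI htI ⟨hrI.1.le, hrI.2⟩)
  have h2 := hM (x r + a • curveU m k (ω * r))
  have h3 : rhsEta f a h ω k (d r) r (x r) (η r) =
      h * (f (x r + a • curveU m k (ω * r)) - η r + d r) := by unfold rhsEta; ring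
  rw [h3, Real.norm_eq_abs, abs_mul, abs_of_nonneg hh]
  gcongr
  exact (abs_add_le _ _).trans (add_le_add ((abs_sub _ _).trans (add_le_add h2 h1)) hr)

/-- Integral over one period of the dither in terms of the average over the angle. -/
theorem integral_period_eq {g : ℝ → ℝ} (hg : Function.Periodic g (2 * Real.pi)) (hω : 0 < ω)
    (s : ℝ) : ∫ r in s..(s + 2 * Real.pi / ω), g (ω * r) =
      (2 * Real.pi / ω) * ((2 * Real.pi)⁻¹ * ∫ τ in (-Real.pi)..Real.pi, g τ) := by
  have hπ := Real.pi_pos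
  rw [intervalIntegral.integral_comp_mul_left _ hω.ne', smul_eq_mul]
  have h1 := hg.intervalIntegral_add_eq (ω * s) (-Real.pi)
  have h2 : ω * (s + 2 * Real.pi / ω) = ω * s + 2 * Real.pi := by field_simp
  have h3 : -Real.pi + 2 * Real.pi = Real.pi := by ring
  rw [h3] at h1
  rw [h2, h1]
  field_simp

/-- Over one period of the dither, the averaged objective increases as along the averaged
gradient system, up to small errors. -/
theorem exists_period_increase {C L : NNReal} {M : ℝ} (hf : ContDiff ℝ 1 f)
    (hC : LipschitzWith C f) (hL : LipschitzWith L (fderiv ℝ f)) (hM : ∀ x, |f x| ≤ M)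
    (ha : 0 < a) (hb : 0 < b) (hh : 0 < h) {ρ δ : ℝ} (hρ : 0 ≤ ρ) (hδ : 0 ≤ δ) :
    ∃ B₁ B₂ : ℝ, 0 ≤ B₁ ∧ 0 ≤ B₂ ∧ ∀ (ω : ℝ) (k : ℕ) (d : ℝ → ℝ) (t₀ : ℝ) (x₀ : State m) (η₀ : ℝ)
      (I : Set ℝ) (x : ℝ → State m) (η : ℝ → ℝ) (D : ℝ), 0 < ω → 1 ≤ k →
      IsSolution f a b h ω k d t₀ x₀ η₀ I x η → (∀ t ∈ I, |η t| ≤ ρ) → (∀ᵐ s, |d s| ≤ D) →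
      0 ≤ D → D ≤ δ → ∀ s ∈ I, s + 2 * Real.pi / ω ∈ I →
      avgObj f a (x s) + (2 * Real.pi / ω) * (b * avgGain m a * ‖gradient (avgObj f a) (x s)‖ ^ 2 -
        b * D * ‖gradient (avgObj f a) (x s)‖ -
          (B₁ * (1 / 2) ^ k + B₂ * (2 * Real.pi / ω))) ≤
        avgObj f a (x (s + 2 * Real.pi / ω)) := by
  have hM0 : 0 ≤ M := (abs_nonneg _).trans (hM 0)
  obtain ⟨A, hA0, hA⟩ := exists_average_dither_error hf hC hM ha ρ
  -- `S` bounds |f - η + d|, so x has speed at most bS and η at most hS.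
  let S := M + ρ + δ
  have hS : 0 ≤ S := by positivity
  -- The first constant is the averaging error with ‖∇W‖ ≤ C. The second collects the drift of x and
  -- η within a period and the Taylor remainder. The disturbance term keeps its factor ‖∇W‖, so that
  -- it can later be absorbed into the square.
  refine ⟨b * A * C, (b * (C * (b * S) + h * S)) * C + L * (b * S) ^ 2, by positivity,
    by positivity, ?_⟩
  intro ω k d t₀ x₀ η₀ I x η D hω hk hs hη hD hD0 hDδ s hsI hsI'
  have hDδ' : ∀ᵐ s, |d s| ≤ δ := hD.mono fun s h => h.trans hDδ
  set τ := 2 * Real.pi / ω with hτdef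
  have hτ : 0 < τ := by have := Real.pi_pos; positivity
  have hsub : Icc s (s + τ) ⊆ I := hs.ordConnected.out hsI hsI'
  set p := gradient (avgObj f a) (x s) with hp
  have hpC : ‖p‖ ≤ C := norm_gradient_avgObj_le hf hC a _
  have hx : ∀ r ∈ Icc s (s + τ), ‖x r - x s‖ ≤ b * S * τ := fun r hr =>
    (hs.norm_x_sub_le hb.le hM hη hDδ' hsI (hsub hr) hr.1).trans (by
      have := hr.2
      gcongr
      linarith)
  have he : ∀ r ∈ Icc s (s + τ), |η r - η s| ≤ h * S * τ := fun r hr =>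
    (hs.abs_eta_sub_le hh.le hM hη hDδ' hsI (hsub hr) hr.1).trans (by
      have := hr.2
      gcongr
      linarith)
  -- The integrand with state and filter frozen at the start of the period and without disturbance;
  -- it is periodic in the dither angle.
  let g : ℝ → ℝ := fun σ => (f (x s + a • curveU m k σ) - η s) * inner ℝ (ditherV m k σ) p
  have hgc : Continuous g := by
    have := hC.continuous
    fun_prop
  have hgper : Function.Periodic g (2 * Real.pi) := fun σ => by
    simp only [g, curveU_add_two_pi hk, ditherV_add_two_pi hk]
  have hInt : inner ℝ (x (s + τ) - x s) p =
      ∫ r in s..(s + τ), inner ℝ (rhsX f a b ω k (d r) r (x r) (η r)) p := by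
    have hcomm := (innerSL ℝ p).intervalIntegral_comp_comm (hs.intervalIntegrable_x hsI hsI')
    simp only [innerSL_apply_apply] at hcomm
    rw [hs.x_sub hsI hsI', real_inner_comm, ← hcomm]
    refine intervalIntegral.integral_congr fun r _ => ?_
    exact real_inner_comm _ _
  have hii : IntervalIntegrable (fun r => inner ℝ (rhsX f a b ω k (d r) r (x r) (η r)) p)
      volume s (s + τ) := by
    have := hs.intervalIntegrable_x hsI hsI'
    exact ⟨this.1.inner_const p, this.2.inner_const p⟩
  have hgi : IntervalIntegrable (fun r => b * g (ω * r)) volume s (s + τ) :=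
    (Continuous.intervalIntegrable (by fun_prop) _ _)
  have hdiff : |inner ℝ (x (s + τ) - x s) p - ∫ r in s..(s + τ), b * g (ω * r)| ≤
      b * (C * (b * S * τ) + h * S * τ + D) * ‖p‖ * (s + τ - s) := by
    rw [hInt, ← intervalIntegral.integral_sub hii hgi, ← Real.norm_eq_abs]
    refine norm_integral_le_of_ae_le (by linarith) ?_
    filter_upwards [hD] with r hr hrI
    have hrI' : r ∈ Icc s (s + τ) := ⟨hrI.1.le, hrI.2⟩
    have h1 : |f (x r + a • curveU m k (ω * r)) - f (x s + a • curveU m k (ω * r))| ≤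
        C * (b * S * τ) := by
      rw [← Real.dist_eq]
      refine (hC.dist_le_mul _ _).trans ?_
      rw [dist_add_right, dist_eq_norm]
      gcongr
      exact hx r hrI'
    have h2 := he r hrI'
    have h3 : |inner ℝ (ditherV m k (ω * r)) p| ≤ ‖p‖ := by
      refine (abs_real_inner_le_norm _ _).trans ?_
      exact mul_le_of_le_one_left (norm_nonneg _) (norm_ditherV_le _ _ _)
    rw [rhsX_eq, real_inner_smul_left, Real.norm_eq_abs]
    have h4 : b * (f (x r + a • curveU m k (ω * r)) - η r + d r) *
        inner ℝ (ditherV m k (ω * r)) p - b * g (ω * r) =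
        b * ((f (x r + a • curveU m k (ω * r)) - f (x s + a • curveU m k (ω * r))) -
          (η r - η s) + d r) * inner ℝ (ditherV m k (ω * r)) p := by
      simp only [g]; ring
    rw [h4, abs_mul, abs_mul, abs_of_pos hb]
    gcongr
    exact (abs_add_le _ _).trans (add_le_add ((abs_sub _ _).trans (add_le_add h1 h2)) hr)
  have hav := hA k (x s) p (η s) hk (hη s hsI)
  rw [real_inner_self_eq_norm_sq] at hav
  rw [intervalIntegral.integral_const_mul, integral_period_eq hgper hω, ← hτdef] at hdiff
  set Q := (2 * Real.pi)⁻¹ * ∫ σ in (-Real.pi)..Real.pi, g σ with hQ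
  have hav' : avgGain m a * ‖p‖ ^ 2 - A * (1 / 2) ^ k * ‖p‖ ≤ Q := by
    have := (abs_le.1 hav).1
    linarith
  have hdiff' := (abs_le.1 hdiff).1
  have hinner : τ * (b * (avgGain m a * ‖p‖ ^ 2 - A * (1 / 2) ^ k * ‖p‖)) -
      b * (C * (b * S * τ) + h * S * τ + D) * ‖p‖ * τ ≤ inner ℝ (x (s + τ) - x s) p := by
    have h5 : τ * (b * (avgGain m a * ‖p‖ ^ 2 - A * (1 / 2) ^ k * ‖p‖)) ≤ b * (τ * Q) := by
      calc _ ≤ τ * (b * Q) := by gcongr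
        _ = _ := by ring
    have h6 : s + τ - s = τ := by ring
    rw [h6] at hdiff'
    linarith
  have htay := (abs_le.1 (avgObj_sub_sub_inner_le hf hC hL a (x s) (x (s + τ)))).1
  rw [← hp, real_inner_comm] at htay
  have hΔ := hx (s + τ) ⟨by linarith, le_rfl⟩
  have hquad : L * ‖x (s + τ) - x s‖ * ‖x (s + τ) - x s‖ ≤ L * (b * S * τ) * (b * S * τ) := by
    gcongr
  have hp1 : A * (1 / 2) ^ k * ‖p‖ ≤ A * (1 / 2) ^ k * C := by gcongr
  have hp2 : (C * (b * S * τ) + h * S * τ) * ‖p‖ ≤ (C * (b * S * τ) + h * S * τ) * C := by gcongr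
  have hp1' := mul_le_mul_of_nonneg_left hp1 (mul_pos hτ hb).le
  have hp2' := mul_le_mul_of_nonneg_left hp2 (mul_pos hτ hb).le
  have hexp : τ * (b * avgGain m a * ‖p‖ ^ 2 - b * D * ‖p‖ -
      (b * A * C * (1 / 2) ^ k + ((b * (C * (b * S) + h * S)) * C + L * (b * S) ^ 2) * τ)) =
      (τ * (b * (avgGain m a * ‖p‖ ^ 2 - A * (1 / 2) ^ k * ‖p‖)) -
        b * (C * (b * S * τ) + h * S * τ + D) * ‖p‖ * τ) - L * (b * S * τ) * (b * S * τ) +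
      (τ * b * (A * (1 / 2) ^ k * ‖p‖) - τ * b * (A * (1 / 2) ^ k * C)) +
      (τ * b * ((C * (b * S * τ) + h * S * τ) * ‖p‖) -
        τ * b * ((C * (b * S * τ) + h * S * τ) * C)) := by ring
  rw [hexp]
  linarith

end ExtremumSeeking

end

/-! ### From sampled dissipation to practical input-to-state stability -/

noncomputable section

namespace ExtremumSeeking

/-- The guaranteed rate of decrease of the suboptimality. -/
def decreaseRate (q : ℝ) (α : ℝ ≃o ℝ) (u : ℝ) : ℝ := q / 4 * (α u * |α u|)

theorem continuous_decreaseRate (q : ℝ) (α : ℝ ≃o ℝ) : Continuous (decreaseRate q α) := by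
  have := α.continuous
  unfold decreaseRate
  fun_prop

/-- The signed square y|y| replaces y² so that monotonicity holds on all of ℝ, without sign
conditions on the suboptimality. -/
theorem strictMono_decreaseRate {q : ℝ} (hq : 0 < q) (α : ℝ ≃o ℝ) :
    StrictMono (decreaseRate q α) := by
  intro u v huv
  have h := α.strictMono huv
  unfold decreaseRate
  refine mul_lt_mul_of_pos_left ?_ (by positivity)
  rcases le_total 0 (α u) with h1 | h1
  · rw [abs_of_nonneg h1, abs_of_nonneg (h1.trans h.le)]
    nlinarith
  · rw [abs_of_nonpos h1]
    rcases le_total 0 (α v) with h2 | h2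
    · rw [abs_of_nonneg h2]
      rcases h1.eq_or_lt with h3 | h3
      · rw [h3] at h ⊢; nlinarith
      · nlinarith [mul_pos_of_neg_of_neg h3 h3, mul_nonneg h2 h2]
    · rw [abs_of_nonpos h2]
      nlinarith

theorem decreaseRate_zero {q : ℝ} {α : ℝ ≃o ℝ} (hα : α 0 = 0) : decreaseRate q α 0 = 0 := by
  simp [decreaseRate, hα]

/-- Practical input-to-state stability from a sampled dissipation inequality. -/
theorem practical_iss_of_sampled_decrease {E : Type*} [PseudoMetricSpace E] {W G : E → ℝ}
    {K : Set E} {ystar S₀ : ℝ} {α : ℝ ≃o ℝ} (hα0 : α 0 = 0) {b c : ℝ} (hb : 0 < b) (hc : 0 < c)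
    (hK : ∀ z ∈ K, ystar - W z ≤ S₀)
    (hK' : ∀ z ∈ K, ∀ z', dist z' z ≤ 1 → ystar - W z' ≤ S₀ → z' ∈ K)
    (hα : ∀ z ∈ K, 0 ≤ ystar - W z → α (ystar - W z) ≤ G z) {β : ℝ → ℝ → ℝ}
    (hβ : ∀ s t, 0 ≤ s → 0 ≤ t → 0 ≤ β s t ∧ β s t + t * decreaseRate (b * c) α (β s t) = s)
    {x : ℝ → E} {t₀ t₁ τ σ v D e ε ε₁ : ℝ} (hτ : 0 < τ) (hσ : 0 ≤ σ) (hv : 0 ≤ v) (hD : 0 ≤ D)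
    (hε₁ : 0 < ε₁) (hx0 : x t₀ ∈ K)
    (hdec : ∀ s ∈ Icc t₀ t₁, s + τ ∈ Icc t₀ t₁ →
      W (x s) + τ * (b * c * G (x s) ^ 2 - b * D * G (x s) - e) ≤ W (x (s + τ)))
    (hW : ∀ s ∈ Icc t₀ t₁, ∀ t ∈ Icc t₀ t₁, s ≤ t → |W (x t) - W (x s)| ≤ σ * (t - s))
    (hx : ∀ s ∈ Icc t₀ t₁, ∀ t ∈ Icc t₀ t₁, s ≤ t → dist (x t) (x s) ≤ v * (t - s))
    (he : e ≤ decreaseRate (b * c) α ε₁) (hvτ : v * τ ≤ 1) (hε : ε₁ + 2 * (σ * τ) ≤ ε)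
    (hε' : τ * decreaseRate (b * c) α S₀ + σ * τ ≤ ε)
    (hS : max (α.symm (2 * D / c)) ε₁ + σ * τ ≤ S₀) :
    ∀ t ∈ Icc t₀ t₁, (∃ z ∈ K, dist (x t) z ≤ 1) ∧ ystar - W (x t) ≤
      max (β (max (ystar - W (x t₀)) 0) (t - t₀)) (α.symm (2 * D / c)) + ε := by
  have hm := strictMono_decreaseRate (mul_pos hb hc) α
  have hl0 : decreaseRate (b * c) α 0 = 0 := decreaseRate_zero hα0
  set lam := decreaseRate (b * c) α with hlam
  set γ := α.symm (2 * D / c) with hγ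
  have hγ0 : 0 ≤ γ := by
    rw [hγ, ← α.le_iff_le, hα0, OrderIso.apply_symm_apply]; positivity
  have hστ : 0 ≤ σ * τ := by positivity
  intro t ht
  set N := ⌊(t - t₀) / τ⌋₊ with hN
  have hquot : 0 ≤ (t - t₀) / τ := div_nonneg (sub_nonneg.2 ht.1) hτ.le
  have hNle : N * τ ≤ t - t₀ := (le_div_iff₀ hτ).1 (Nat.floor_le hquot)
  have hNlt : t - t₀ < (N + 1) * τ := (div_lt_iff₀ hτ).1 (Nat.lt_floor_add_one _)
  let T : ℕ → ℝ := fun j => t₀ + j * τ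
  have hT : ∀ j ≤ N, T j ∈ Icc t₀ t₁ := fun j hj => by
    have h1 : (j : ℝ) * τ ≤ N * τ := by gcongr
    have h2 : 0 ≤ (j : ℝ) * τ := by positivity
    have := ht.2
    constructor <;> simp only [T] <;> linarith
  have hTs : ∀ j, T (j + 1) = T j + τ := fun j => by simp only [T]; push_cast; ring
  let y : ℕ → ℝ := fun j => ystar - W (x (T j))
  have hinc : ∀ j < N, y (j + 1) ≤ y j + σ * τ := fun j hj => by
    have h1 := hW (T j) (hT j hj.le) (T (j + 1)) (hT (j + 1) hj) (by rw [hTs]; linarith)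
    rw [hTs, add_sub_cancel_left, ← hTs] at h1
    have := (abs_le.1 h1).1
    simp only [y]
    linarith
  -- Above γ one has 2D ≤ cα(y) ≤ cG, so half of bcG² pays for the disturbance. Of the remaining
  -- bcG²/2 ≥ 2λ(y), one λ(y) ≥ λ(ε₁) ≥ e pays for the error and the other is the decrease.
  have hdecr : ∀ j < N, x (T j) ∈ K → max γ ε₁ ≤ y j → y (j + 1) ≤ y j - τ * lam (y j) :=
    fun j hj hjK hyj => by
    have h1 := hdec (T j) (hT j hj.le) (by rw [← hTs]; exact hT (j + 1) hj)
    rw [← hTs] at h1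
    have hy1 : γ ≤ y j := (le_max_left _ _).trans hyj
    have hy2 : ε₁ ≤ y j := (le_max_right _ _).trans hyj
    have h2 : α (y j) ≤ G (x (T j)) := hα _ hjK (hγ0.trans hy1)
    have h3 : 2 * D / c ≤ α (y j) := by
      rw [← α.apply_symm_apply (2 * D / c)]; exact α.monotone hy1
    have h4 : 0 < α (y j) := by
      have := α.strictMono (hε₁.trans_le hy2); rwa [hα0] at this
    have h5 : lam (y j) = b * c / 4 * α (y j) ^ 2 := by
      simp only [hlam, decreaseRate, abs_of_pos h4]; ring
    have h6 : e ≤ lam (y j) := he.trans (hm.monotone hy2)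
    rw [div_le_iff₀ hc] at h3
    set g := G (x (T j))
    have h7 : b * D * g ≤ b * c / 2 * g ^ 2 := by
      have : 2 * D ≤ g * c := h3.trans (by gcongr)
      have h8 : 0 ≤ b * g := mul_nonneg hb.le (h4.le.trans h2)
      nlinarith
    have h8 : b * c / 2 * α (y j) ^ 2 ≤ b * c / 2 * g ^ 2 := by gcongr
    have h9 : lam (y j) ≤ b * c * g ^ 2 - b * D * g - e := by linarith
    have h10 := mul_le_mul_of_nonneg_left h9 hτ.le
    simp only [y] at h10 ⊢
    linarith
  -- At sampling times `K` is never left: above the level the suboptimality decreases, and below it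
  -- a rise of at most στ still stays under S₀ by `hS`.
  have hmem : ∀ j ≤ N, x (T j) ∈ K := by
    intro j
    induction j with
    | zero => intro _; simpa [T] using hx0
    | succ j ih =>
      intro hj
      have hjK := ih (by omega)
      refine hK' _ hjK _ ?_ ?_
      · refine (hx (T j) (hT j (by omega)) (T (j + 1)) (hT _ hj) (by rw [hTs]; linarith)).trans ?_
        rw [hTs, add_sub_cancel_left]
        exact hvτ
      · rcases le_total (max γ ε₁) (y j) with h | h
        · have h1 := hdecr j (by omega) hjK h
          have h2 : 0 ≤ lam (y j) := by
            rw [← hl0]; exact hm.monotone (hγ0.trans ((le_max_left _ _).trans h))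
          have h3 := hK _ hjK
          have : 0 ≤ τ * lam (y j) := by positivity
          change y (j + 1) ≤ S₀
          change y j ≤ S₀ at h3
          linarith
        · have := hinc j (by omega)
          change y (j + 1) ≤ S₀
          linarith
  set s := max (ystar - W (x t₀)) 0 with hs
  have hs0 : 0 ≤ s := le_max_right _ _
  have hy0 : y 0 ≤ s := by simp only [y, T, hs]; simp
  have hdisc := le_or_implicit_of_decrease hm.monotone (y := y) (G := max γ ε₁) (c := σ * τ)
    (T := τ) (s := s) hτ.le (N := N) hy0
    (fun u hu => by rw [← hl0]; exact hm.monotone (hγ0.trans ((le_max_left _ _).trans hu)))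
    (fun j hj => hdecr j hj (hmem j hj.le)) hinc N le_rfl
  have hTt : T N ≤ t := by simp only [T]; linarith
  have htT : t - T N ≤ τ := by simp only [T]; linarith
  have hylast : ystar - W (x t) ≤ y N + σ * τ := by
    have h1 := (abs_le.1 (hW (T N) (hT N le_rfl) t ht hTt)).1
    have h2 : σ * (t - T N) ≤ σ * τ := by gcongr
    simp only [y]
    linarith
  refine ⟨⟨x (T N), hmem N le_rfl, (hx _ (hT N le_rfl) t ht hTt).trans (le_trans ?_ hvτ)⟩, ?_⟩
  · gcongr
  · have htt : 0 ≤ t - t₀ := sub_nonneg.2 ht.1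
    obtain ⟨hβ0, hβeq⟩ := hβ s (t - t₀) hs0 htt
    have hmaxγ : γ ≤ max (β s (t - t₀)) γ := le_max_right _ _
    have hmaxβ : β s (t - t₀) ≤ max (β s (t - t₀)) γ := le_max_left _ _
    rcases hdisc with h | h
    · have : max γ ε₁ ≤ γ + ε₁ := max_le (by linarith) (by linarith)
      linarith
    · have hyS : y N ≤ S₀ := hK _ (hmem N le_rfl)
      -- Otherwise u = β(s, t - t₀) is smaller than y_N by more than τλ(S₀). But t - t₀ < (N+1)τ
      -- gives s = u + (t - t₀)λ(u) ≤ u + τλ(S₀) + Nτλ(y_N) < y_N + Nτλ(y_N) ≤ s. The term τλ(S₀) is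
      -- the cost of the incomplete last period.
      have hkey : y N ≤ β s (t - t₀) + τ * lam S₀ ∨ y N ≤ β s (t - t₀) := by
        by_contra! hcon
        have h1 : lam (β s (t - t₀)) ≤ lam (y N) := hm.monotone hcon.2.le
        have h2 : 0 ≤ lam (y N) := by rw [← hl0]; exact hm.monotone (hβ0.trans hcon.2.le)
        have h3 : lam (y N) ≤ lam S₀ := hm.monotone hyS
        have h4 : (t - t₀) * lam (β s (t - t₀)) ≤ (t - t₀) * lam (y N) := by gcongr
        have h5 : (t - t₀) * lam (y N) ≤ (N + 1) * τ * lam (y N) := by gcongr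
        have h6 : τ * lam (y N) ≤ τ * lam S₀ := by gcongr
        linarith [hcon.1]
      rcases hkey with h1 | h1 <;> linarith

end ExtremumSeeking

end

/-! ### Maximal solutions and forward uniqueness -/

noncomputable section

namespace ExtremumSeeking

/-- The set I need be neither open nor closed. Near t it is bracketed by two of its own points, t
itself serving as a bracket if it is an endpoint, and the primitive is continuous between them. -/
theorem continuousOn_primitive_of_intervalIntegrable {E : Type*} [NormedAddCommGroup E]
    [NormedSpace ℝ E] {g : ℝ → E} {I : Set ℝ} {t₀ : ℝ} (hg : ∀ t ∈ I, IntervalIntegrable g volume t₀ t) :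
    ContinuousOn (fun t => ∫ s in t₀..t, g s) I := by
  intro t ht
  obtain ⟨s₁, hs₁, hle₁, hnb₁⟩ : ∃ s ∈ I, s ≤ t ∧ ∀ᶠ r in 𝓝[I] t, s ≤ r := by
    by_cases h : ∃ s ∈ I, s < t
    · obtain ⟨s, hs, hst⟩ := h
      exact ⟨s, hs, hst.le, eventually_nhdsWithin_of_eventually_nhds (eventually_ge_nhds hst)⟩
    · push Not at h
      exact ⟨t, ht, le_rfl, eventually_mem_nhdsWithin.mono h⟩
  obtain ⟨s₂, hs₂, hle₂, hnb₂⟩ : ∃ s ∈ I, t ≤ s ∧ ∀ᶠ r in 𝓝[I] t, r ≤ s := by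
    by_cases h : ∃ s ∈ I, t < s
    · obtain ⟨s, hs, hst⟩ := h
      exact ⟨s, hs, hst.le, eventually_nhdsWithin_of_eventually_nhds (eventually_le_nhds hst)⟩
    · push Not at h
      exact ⟨t, ht, le_rfl, eventually_mem_nhdsWithin.mono h⟩
  have h12 : IntervalIntegrable g volume s₁ s₂ := (hg s₁ hs₁).symm.trans (hg s₂ hs₂)
  have hc : ContinuousOn (fun r => ∫ s in s₁..r, g s) (Icc s₁ s₂) := by
    have := intervalIntegral.continuousOn_primitive_interval' h12 left_mem_uIcc
    rwa [uIcc_of_le (hle₁.trans hle₂)] at this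
  have hc' : ContinuousOn (fun r => (∫ s in t₀..s₁, g s) + ∫ s in s₁..r, g s) (Icc s₁ s₂) :=
    continuousOn_const.add hc
  have hcw := (hc' t ⟨hle₁, hle₂⟩)
  have hmem : Icc s₁ s₂ ∈ 𝓝[I] t := by
    filter_upwards [hnb₁, hnb₂] with r h1 h2 using ⟨h1, h2⟩
  refine (hcw.mono_of_mem_nhdsWithin hmem).congr (fun r hr => ?_) ?_
  · exact (intervalIntegral.integral_add_adjacent_intervals (hg s₁ hs₁)
      ((hg s₁ hs₁).symm.trans (hg r hr))).symm
  · exact (intervalIntegral.integral_add_adjacent_intervals (hg s₁ hs₁)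
      ((hg s₁ hs₁).symm.trans (hg t ht))).symm

variable {m : ℕ} {J f : State m → ℝ} {a b h ω : ℝ} {k : ℕ} {d : ℝ → ℝ} {t₀ : ℝ} {x₀ : State m}
  {η₀ : ℝ} {I I' : Set ℝ} {x x' : ℝ → State m} {η η' : ℝ → ℝ}

/-- A pair of functions is a solution if it agrees near each time, back to the initial time, with
a solution. -/
theorem isSolution_of_locally (hmem : t₀ ∈ I) (hI : I.OrdConnected)
    (hloc : ∀ t ∈ I, ∃ (I' : Set ℝ) (x' : ℝ → State m) (η' : ℝ → ℝ),
      IsSolution J a b h ω k d t₀ x₀ η₀ I' x' η' ∧ t ∈ I' ∧ EqOn x x' (uIcc t₀ t) ∧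
        EqOn η η' (uIcc t₀ t)) :
    IsSolution J a b h ω k d t₀ x₀ η₀ I x η := by
  have hix : ∀ t ∈ I,
      IntervalIntegrable (fun s => rhsX J a b ω k (d s) s (x s) (η s)) volume t₀ t := by
    intro t ht
    obtain ⟨I', x', η', hs, htI', hx, hη⟩ := hloc t ht
    refine (hs.integrable_x t htI').congr fun s hs' => ?_
    simp only [hx (uIoc_subset_uIcc hs'), hη (uIoc_subset_uIcc hs')]
  have hie : ∀ t ∈ I,
      IntervalIntegrable (fun s => rhsEta J a h ω k (d s) s (x s) (η s)) volume t₀ t := by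
    intro t ht
    obtain ⟨I', x', η', hs, htI', hx, hη⟩ := hloc t ht
    refine (hs.integrable_eta t htI').congr fun s hs' => ?_
    simp only [hx (uIoc_subset_uIcc hs'), hη (uIoc_subset_uIcc hs')]
  have hex : ∀ t ∈ I, x t = x₀ + ∫ s in t₀..t, rhsX J a b ω k (d s) s (x s) (η s) := by
    intro t ht
    obtain ⟨I', x', η', hs, htI', hx, hη⟩ := hloc t ht
    rw [hx right_mem_uIcc, hs.eq_x t htI']
    congr 1
    refine intervalIntegral.integral_congr fun s hs' => ?_
    simp only [hx hs', hη hs']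
  have hee : ∀ t ∈ I, η t = η₀ + ∫ s in t₀..t, rhsEta J a h ω k (d s) s (x s) (η s) := by
    intro t ht
    obtain ⟨I', x', η', hs, htI', hx, hη⟩ := hloc t ht
    rw [hη right_mem_uIcc, hs.eq_eta t htI']
    congr 1
    refine intervalIntegral.integral_congr fun s hs' => ?_
    simp only [hx hs', hη hs']
  exact ⟨hmem, hI,
    (continuousOn_const.add (continuousOn_primitive_of_intervalIntegrable hix)).congr hex,
    (continuousOn_const.add (continuousOn_primitive_of_intervalIntegrable hie)).congr hee,
    hix, hie, hex, hee⟩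

theorem IsSolution.mono (hs : IsSolution J a b h ω k d t₀ x₀ η₀ I x η) (hsub : I' ⊆ I)
    (hmem : t₀ ∈ I') (hI' : I'.OrdConnected) : IsSolution J a b h ω k d t₀ x₀ η₀ I' x η :=
  isSolution_of_locally hmem hI' fun _ ht => ⟨I, x, η, hs, hsub ht, fun _ _ => rfl, fun _ _ => rfl⟩

theorem IsSolution.uIcc_subset (hs : IsSolution J a b h ω k d t₀ x₀ η₀ I x η) {t : ℝ}
    (ht : t ∈ I) : uIcc t₀ t ⊆ I :=
  hs.ordConnected.uIcc_subset hs.mem ht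

theorem IsSolution.congr_objective (hs : IsSolution J a b h ω k d t₀ x₀ η₀ I x η)
    (hfJ : ∀ t ∈ I, f (x t + a • curveU m k (ω * t)) = J (x t + a • curveU m k (ω * t))) :
    IsSolution f a b h ω k d t₀ x₀ η₀ I x η := by
  have hx : ∀ t ∈ I, rhsX f a b ω k (d t) t (x t) (η t) = rhsX J a b ω k (d t) t (x t) (η t) :=
    fun t ht => by simp only [rhsX, hfJ t ht]
  have he : ∀ t ∈ I, rhsEta f a h ω k (d t) t (x t) (η t) = rhsEta J a h ω k (d t) t (x t) (η t) :=
    fun t ht => by simp only [rhsEta, hfJ t ht]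
  refine ⟨hs.mem, hs.ordConnected, hs.continuousOn_x, hs.continuousOn_eta, fun t ht => ?_,
    fun t ht => ?_, fun t ht => ?_, fun t ht => ?_⟩
  · exact (hs.integrable_x t ht).congr fun s hs' =>
      (hx s (hs.uIcc_subset ht (uIoc_subset_uIcc hs'))).symm
  · exact (hs.integrable_eta t ht).congr fun s hs' =>
      (he s (hs.uIcc_subset ht (uIoc_subset_uIcc hs'))).symm
  · rw [hs.eq_x t ht]
    congr 1
    exact intervalIntegral.integral_congr fun s hs' => (hx s (hs.uIcc_subset ht hs')).symm
  · rw [hs.eq_eta t ht]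
    congr 1
    exact intervalIntegral.integral_congr fun s hs' => (he s (hs.uIcc_subset ht hs')).symm

/-- Every solution can be extended to a maximal one; in particular, maximal solutions exist. -/
theorem exists_isMaximalSolution (J : State m → ℝ) (a b h ω : ℝ) (k : ℕ) (d : ℝ → ℝ) (t₀ : ℝ)
    (x₀ : State m) (η₀ : ℝ) :
    ∃ (I : Set ℝ) (x : ℝ → State m) (η : ℝ → ℝ),
      IsMaximalSolution J a b h ω k d t₀ x₀ η₀ I x η := by
  let X := {p : Set ℝ × (ℝ → State m) × (ℝ → ℝ) //
    IsSolution J a b h ω k d t₀ x₀ η₀ p.1 p.2.1 p.2.2}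
  -- Only a preorder, since the values outside the interval are arbitrary; Zorn's lemma in its
  -- transitive form still applies.
  let r : X → X → Prop := fun p q =>
    p.1.1 ⊆ q.1.1 ∧ EqOn q.1.2.1 p.1.2.1 p.1.1 ∧ EqOn q.1.2.2 p.1.2.2 p.1.1
  have htrivial : IsSolution J a b h ω k d t₀ x₀ η₀ {t₀} (fun _ => x₀) (fun _ => η₀) := by
    refine ⟨rfl, ordConnected_singleton, continuousOn_const, continuousOn_const, ?_, ?_, ?_, ?_⟩ <;>
    · rintro t rfl
      simp
  have : Std.Refl r := ⟨fun p => ⟨subset_rfl, fun _ _ => rfl, fun _ _ => rfl⟩⟩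
  have hzorn : ∃ p : X, ∀ q, r p q → r q p := by
    refine exists_maximal_of_chains_bounded (fun c hc => ?_) ?_
    · rcases c.eq_empty_or_nonempty with rfl | ⟨p₀, hp₀⟩
      · exact ⟨⟨({t₀}, fun _ => x₀, fun _ => η₀), htrivial⟩, by simp⟩
      let U : Set ℝ := ⋃ p ∈ c, p.1.1
      have hU : ∀ t, ∃ p : X, t ∈ U → p ∈ c ∧ t ∈ p.1.1 := fun t => by
        by_cases ht : t ∈ U
        · simp only [U, mem_iUnion] at ht
          obtain ⟨p, hpc, hpt⟩ := ht
          exact ⟨p, fun _ => ⟨hpc, hpt⟩⟩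
        · exact ⟨p₀, fun h => absurd h ht⟩
      -- At each time of the union a member of the chain defined there is selected. Members of a
      -- chain agree where both are defined, so the choice does not affect the values.
      choose P hP using hU
      have hcompat : ∀ p ∈ c, ∀ t ∈ p.1.1, (P t).1.2.1 t = p.1.2.1 t ∧ (P t).1.2.2 t = p.1.2.2 t := by
        intro p hpc t ht
        have htU : t ∈ U := mem_biUnion hpc ht
        obtain ⟨hPc, hPt⟩ := hP t htU
        rcases hc.total hpc hPc with h | h
        · exact ⟨h.2.1 ht, h.2.2 ht⟩
        · exact ⟨(h.2.1 hPt).symm, (h.2.2 hPt).symm⟩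
      have hsol : IsSolution J a b h ω k d t₀ x₀ η₀ U (fun t => (P t).1.2.1 t)
          (fun t => (P t).1.2.2 t) := by
        refine isSolution_of_locally (mem_biUnion hp₀ p₀.2.mem) ⟨fun s hs t ht => ?_⟩
          fun t ht => ?_
        · obtain ⟨hPs, hs'⟩ := hP s hs
          obtain ⟨hPt, ht'⟩ := hP t ht
          rcases hc.total hPs hPt with h | h
          · exact ((P t).2.ordConnected.out (h.1 hs') ht').trans
              (subset_biUnion_of_mem (u := fun p : X => p.1.1) hPt)
          · exact ((P s).2.ordConnected.out hs' (h.1 ht')).trans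
              (subset_biUnion_of_mem (u := fun p : X => p.1.1) hPs)
        · obtain ⟨hPc, hPt⟩ := hP t ht
          exact ⟨_, _, _, (P t).2, hPt,
            fun s hs => (hcompat _ hPc s ((P t).2.uIcc_subset hPt hs)).1,
            fun s hs => (hcompat _ hPc s ((P t).2.uIcc_subset hPt hs)).2⟩
      exact ⟨⟨(U, _, _), hsol⟩, fun p hp => ⟨subset_biUnion_of_mem (u := fun p : X => p.1.1) hp,
        fun t ht => (hcompat p hp t ht).1, fun t ht => (hcompat p hp t ht).2⟩⟩
    · intro p q s h1 h2
      exact ⟨h1.1.trans h2.1, fun t ht => (h2.2.1 (h1.1 ht)).trans (h1.2.1 ht),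
        fun t ht => (h2.2.2 (h1.1 ht)).trans (h1.2.2 ht)⟩
  obtain ⟨p, hp⟩ := hzorn
  refine ⟨p.1.1, p.1.2.1, p.1.2.2, p.2, fun I' x' η' hs' hsub hx hη => ?_⟩
  exact (hp ⟨(I', x', η'), hs'⟩ ⟨hsub, hx, hη⟩).1.antisymm hsub

/-- Grönwall's lemma. The integrand is extended constantly beyond the interval, so that its
primitive is differentiable also at the endpoints. -/
theorem eq_zero_of_integral_eq {E : Type*} [NormedAddCommGroup E] [NormedSpace ℝ E]
    [CompleteSpace E] {w g : ℝ → E} {t₁ K : ℝ} (hg : ContinuousOn g (Icc t₀ t₁))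
    (hw : ∀ t ∈ Icc t₀ t₁, w t = ∫ s in t₀..t, g s)
    (hK : ∀ t ∈ Icc t₀ t₁, ‖g t‖ ≤ K * ‖w t‖) : ∀ t ∈ Icc t₀ t₁, w t = 0 := by
  rcases lt_or_ge t₁ t₀ with h | h01
  · intro t ht; exact absurd (ht.1.trans ht.2) (not_le.2 h)
  let G : ℝ → E := IccExtend h01 ((Icc t₀ t₁).domRestrict g)
  have hG : Continuous G := (continuousOn_iff_continuous_domRestrict.1 hg).Icc_extend'
  have hGg : ∀ t ∈ Icc t₀ t₁, G t = g t := fun t ht => IccExtend_of_mem h01 _ ht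
  let V : ℝ → E := fun t => ∫ s in t₀..t, G s
  have hV : ∀ t, HasDerivAt V (G t) t := fun t =>
    intervalIntegral.integral_hasDerivAt_right (hG.intervalIntegrable _ _)
      (hG.stronglyMeasurableAtFilter _ _) hG.continuousAt
  have hVw : ∀ t ∈ Icc t₀ t₁, V t = w t := fun t ht => by
    rw [hw t ht]
    refine intervalIntegral.integral_congr fun s hs => hGg s ?_
    rw [uIcc_of_le ht.1] at hs
    exact ⟨hs.1, hs.2.trans ht.2⟩
  have h0 := eq_zero_of_abs_deriv_le_mul_abs_self_of_eq_zero_right (f := V) (f' := G) (K := K)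
    (a := t₀) (b := t₁) (fun t _ => (hV t).continuousAt.continuousWithinAt)
    (fun t _ => (hV t).hasDerivWithinAt) (by simp [V]) (fun t ht => by
      have ht' : t ∈ Icc t₀ t₁ := ⟨ht.1, ht.2.le⟩
      rw [hGg t ht', hVw t ht']
      exact hK t ht')
  intro t ht
  rw [← hVw t ht, h0 t ht]

/-- Forward uniqueness for a Lipschitz objective function. -/
theorem IsSolution.eqOn_of_lipschitz {C : NNReal} (hC : LipschitzWith C f) {b h : NNReal} {t₁ : ℝ}
    (hs : IsSolution f a b h ω k d t₀ x₀ η₀ (Icc t₀ t₁) x η)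
    (hs' : IsSolution f a b h ω k d t₀ x₀ η₀ (Icc t₀ t₁) x' η') :
    EqOn x x' (Icc t₀ t₁) ∧ EqOn η η' (Icc t₀ t₁) := by
  obtain ⟨ρ₁, hρ₁⟩ := isCompact_Icc.exists_bound_of_continuousOn hs.continuousOn_eta
  obtain ⟨ρ₂, hρ₂⟩ := isCompact_Icc.exists_bound_of_continuousOn hs'.continuousOn_eta
  -- A clamp at this level affects neither solution, so the Lipschitz bound of the clamped field may
  -- be reused.
  set ρ := max ρ₁ ρ₂
  have hcl : ∀ y : ℝ, |y| ≤ ρ → max (-ρ) (min y ρ) = y := fun y hy => by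
    have := abs_le.1 hy
    rw [min_eq_left this.2, max_eq_right this.1]
  have h1 : ∀ t ∈ Icc t₀ t₁, max (-ρ) (min (η t) ρ) = η t := fun t ht =>
    hcl _ ((hρ₁ t ht).trans (le_max_left _ _))
  have h2 : ∀ t ∈ Icc t₀ t₁, max (-ρ) (min (η' t) ρ) = η' t := fun t ht =>
    hcl _ ((hρ₂ t ht).trans (le_max_right _ _))
  have hvc := continuous_clampedField hC.continuous a b h ω k ρ
  have hvl := lipschitzWith_clampedField hC a ω k ρ b h
  obtain ⟨v, hv⟩ : ∃ v, v = clampedField f a b h ω k ρ := ⟨_, rfl⟩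
  rw [← hv] at hvc hvl
  -- The disturbance enters additively and cancels in the difference, which is therefore continuous
  -- in time.
  let g : ℝ → State m × ℝ := fun t => v t (x t, η t) - v t (x' t, η' t)
  have hgc : ContinuousOn g (Icc t₀ t₁) := by
    have hc1 := hvc.comp_continuousOn (continuousOn_id.prodMk
      (hs.continuousOn_x.prodMk hs.continuousOn_eta))
    have hc2 := hvc.comp_continuousOn (continuousOn_id.prodMk
      (hs'.continuousOn_x.prodMk hs'.continuousOn_eta))
    exact hc1.sub hc2
  have hgx : ∀ t ∈ Icc t₀ t₁, (g t).1 =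
      rhsX f a b ω k (d t) t (x t) (η t) - rhsX f a b ω k (d t) t (x' t) (η' t) := fun t ht => by
    simp only [g, hv, clampedField, Prod.fst_sub, h1 t ht, h2 t ht, rhsX]
    module
  have hge : ∀ t ∈ Icc t₀ t₁, (g t).2 =
      rhsEta f a h ω k (d t) t (x t) (η t) - rhsEta f a h ω k (d t) t (x' t) (η' t) :=
    fun t ht => by
    simp only [g, hv, clampedField, Prod.snd_sub, h1 t ht, h2 t ht, rhsEta]
    ring
  have hw : ∀ t ∈ Icc t₀ t₁, (x t - x' t, η t - η' t) = ∫ s in t₀..t, g s := fun t ht => by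
    have hsub := hs.uIcc_subset ht
    have hgi : IntervalIntegrable g volume t₀ t := (hgc.mono hsub).intervalIntegrable
    have e1 := (ContinuousLinearMap.fst ℝ (State m) ℝ).intervalIntegral_comp_comm hgi
    have e2 := (ContinuousLinearMap.snd ℝ (State m) ℝ).intervalIntegral_comp_comm hgi
    simp only [ContinuousLinearMap.coe_fst'] at e1
    simp only [ContinuousLinearMap.coe_snd'] at e2
    refine Prod.ext ?_ ?_
    · rw [← e1, intervalIntegral.integral_congr fun s hs1 => hgx s (hsub hs1),
        intervalIntegral.integral_sub (hs.integrable_x t ht) (hs'.integrable_x t ht)]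
      simp only
      rw [hs.eq_x t ht, hs'.eq_x t ht, add_sub_add_left_eq_sub]
    · rw [← e2, intervalIntegral.integral_congr fun s hs1 => hge s (hsub hs1),
        intervalIntegral.integral_sub (hs.integrable_eta t ht) (hs'.integrable_eta t ht)]
      simp only
      rw [hs.eq_eta t ht, hs'.eq_eta t ht, add_sub_add_left_eq_sub]
  have hbound : ∀ t ∈ Icc t₀ t₁, ‖g t‖ ≤
      (max (b * (C + 1)) (h * (C + 1)) : NNReal) * ‖(x t - x' t, η t - η' t)‖ := fun t _ => by
    have h3 := (hvl t).dist_le_mul (x t, η t) (x' t, η' t)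
    rwa [dist_eq_norm, dist_eq_norm] at h3
  have hzero := eq_zero_of_integral_eq hgc hw hbound
  exact ⟨fun t ht => sub_eq_zero.1 (congrArg Prod.fst (hzero t ht)),
    fun t ht => sub_eq_zero.1 (congrArg Prod.snd (hzero t ht))⟩

/-- Forward uniqueness for a smooth objective function. -/
theorem IsSolution.eqOn_of_contDiff (hJ : ContDiff ℝ ((⊤ : ℕ∞) : WithTop ℕ∞) J) (hb : 0 ≤ b)
    (hh : 0 ≤ h) {t₁ : ℝ} (hs : IsSolution J a b h ω k d t₀ x₀ η₀ (Icc t₀ t₁) x η)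
    (hs' : IsSolution J a b h ω k d t₀ x₀ η₀ (Icc t₀ t₁) x' η') :
    EqOn x x' (Icc t₀ t₁) ∧ EqOn η η' (Icc t₀ t₁) := by
  obtain ⟨R₁, hR₁⟩ := isCompact_Icc.exists_bound_of_continuousOn hs.continuousOn_x
  obtain ⟨R₂, hR₂⟩ := isCompact_Icc.exists_bound_of_continuousOn hs'.continuousOn_x
  -- Both solutions are bounded on the compact interval, so J may be replaced by a Lipschitz
  -- function that agrees with it at all points where it is evaluated.
  obtain ⟨f, -, C, -, hfJ, -, hC, -⟩ := exists_truncation hJ (max R₁ R₂ + |a|)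
  have hnorm : ∀ (z : State m) (σ : ℝ), ‖z‖ ≤ max R₁ R₂ →
      f (z + a • curveU m k σ) = J (z + a • curveU m k σ) := fun z σ hz => by
    refine hfJ _ ((norm_add_le _ _).trans ?_)
    rw [norm_smul, norm_curveU, mul_one, Real.norm_eq_abs]
    gcongr
  have h1 := hs.congr_objective (f := f) fun t ht =>
    hnorm _ _ ((hR₁ t ht).trans (le_max_left _ _))
  have h2 := hs'.congr_objective (f := f) fun t ht =>
    hnorm _ _ ((hR₂ t ht).trans (le_max_right _ _))
  lift b to NNReal using hb
  lift h to NNReal using hh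
  exact h1.eqOn_of_lipschitz hC h2

/-- A maximal solution extends every forward solution. -/
theorem IsMaximalSolution.eqOn_forward (hJ : ContDiff ℝ ((⊤ : ℕ∞) : WithTop ℕ∞) J) (hb : 0 ≤ b)
    (hh : 0 ≤ h) {t₁ : ℝ} (hmax : IsMaximalSolution J a b h ω k d t₀ x₀ η₀ I x η)
    (hs' : IsSolution J a b h ω k d t₀ x₀ η₀ (Icc t₀ t₁) x' η') :
    Icc t₀ t₁ ⊆ I ∧ EqOn x x' (Icc t₀ t₁) ∧ EqOn η η' (Icc t₀ t₁) := by
  classical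
  have hs := hmax.isSolution
  have hagree : ∀ t ∈ I, t ∈ Icc t₀ t₁ → EqOn x x' (Icc t₀ t) ∧ EqOn η η' (Icc t₀ t) :=
    fun t ht ht' =>
      (hs.mono (hs.ordConnected.out hs.mem ht) ⟨le_rfl, ht'.1⟩ ordConnected_Icc).eqOn_of_contDiff
        hJ hb hh (hs'.mono (Icc_subset_Icc_right ht'.2) ⟨le_rfl, ht'.1⟩ ordConnected_Icc)
  -- By uniqueness the two solutions glue to one on the union of the intervals; maximality then
  -- forces the forward interval into I.
  let X : ℝ → State m := fun t => if t ∈ I then x t else x' t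
  let H : ℝ → ℝ := fun t => if t ∈ I then η t else η' t
  have hXI : EqOn X x I := fun t ht => if_pos ht
  have hHI : EqOn H η I := fun t ht => if_pos ht
  have hX' : EqOn X x' (Icc t₀ t₁) := fun t ht => by
    by_cases h : t ∈ I
    · rw [hXI h]; exact (hagree t h ht).1 ⟨ht.1, le_rfl⟩
    · exact if_neg h
  have hH' : EqOn H η' (Icc t₀ t₁) := fun t ht => by
    by_cases h : t ∈ I
    · rw [hHI h]; exact (hagree t h ht).2 ⟨ht.1, le_rfl⟩
    · exact if_neg h
  have hord : (I ∪ Icc t₀ t₁).OrdConnected :=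
    (hs.ordConnected.isPreconnected.union t₀ hs.mem hs'.mem isPreconnected_Icc).ordConnected
  have hsol : IsSolution J a b h ω k d t₀ x₀ η₀ (I ∪ Icc t₀ t₁) X H := by
    refine isSolution_of_locally (Or.inl hs.mem) hord fun t ht => ?_
    rcases ht with ht | ht
    · exact ⟨I, x, η, hs, ht, hXI.mono (hs.uIcc_subset ht), hHI.mono (hs.uIcc_subset ht)⟩
    · exact ⟨_, x', η', hs', ht, hX'.mono (hs'.uIcc_subset ht), hH'.mono (hs'.uIcc_subset ht)⟩
  have hI := hmax.maximal _ X H hsol subset_union_left hXI hHI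
  have hsub : Icc t₀ t₁ ⊆ I := by rw [← hI]; exact subset_union_right
  exact ⟨hsub, fun t ht => (hagree t (hsub ht) ht).1 ⟨ht.1, le_rfl⟩,
    fun t ht => (hagree t (hsub ht) ht).2 ⟨ht.1, le_rfl⟩⟩

end ExtremumSeeking

end

/-! ### Disturbances in L∞, parameter thresholds, and the conclusion -/

noncomputable section

namespace ExtremumSeeking

theorem ae_abs_le_norm_Lp_top (d : Lp ℝ ⊤ (volume : Measure ℝ)) : ∀ᵐ s, |d s| ≤ ‖d‖ := by
  have h : ∀ᵐ s, ‖d s‖ₑ ≤ eLpNormEssSup d volume := ae_le_eLpNormEssSup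
  have hfin : eLpNormEssSup d volume ≠ ⊤ := by
    rw [← eLpNorm_exponent_top]; exact (Lp.memLp d).2.ne
  filter_upwards [h] with s hs
  rw [Lp.norm_def, eLpNorm_exponent_top, ← Real.norm_eq_abs, ← toReal_enorm]
  exact ENNReal.toReal_mono hfin hs

theorem intervalIntegrable_Lp_top (d : Lp ℝ ⊤ (volume : Measure ℝ)) (s t : ℝ) :
    IntervalIntegrable d volume s t := by
  have h : ∀ u v : ℝ, IntegrableOn d (Ioc u v) := fun u v => by
    have : IsFiniteMeasure (volume.restrict (Ioc u v)) := ⟨by simp⟩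
    exact ((Lp.memLp d).restrict (Ioc u v)).integrable le_top
  exact ⟨h s t, h t s⟩

/-- Sufficiently short dither periods satisfy the smallness conditions of the stability estimate. -/
theorem exists_period_threshold {B₂ l ν v r₁ r₂ r₃ lS : ℝ} (hl : 0 < l) (h1 : 0 < r₁)
    (h2 : 0 < r₂) (h3 : 0 < r₃) : ∃ ω₀ : ℝ, 0 < ω₀ ∧ ∀ ω, ω₀ ≤ ω →
      B₂ * (2 * Real.pi / ω) ≤ l ∧ v * (2 * Real.pi / ω) ≤ 1 ∧ 2 * (ν * (2 * Real.pi / ω)) ≤ r₁ ∧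
      2 * Real.pi / ω * lS + ν * (2 * Real.pi / ω) ≤ r₂ ∧ ν * (2 * Real.pi / ω) ≤ r₃ := by
  have hlim : Tendsto (fun ω : ℝ => 2 * Real.pi / ω) atTop (𝓝 0) :=
    tendsto_const_nhds.div_atTop tendsto_id
  -- Each condition is continuous in the period and strict when the period is 0.
  have key : ∀ (F : ℝ → ℝ) (r : ℝ), Continuous F → F 0 < r →
      ∀ᶠ ω in atTop, F (2 * Real.pi / ω) ≤ r := fun F r hF h0 =>
    ((hF.tendsto 0).comp hlim).eventually_le_const h0
  have hall := (key (fun τ => B₂ * τ) l (by fun_prop) (by simpa)).and <|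
    (key (fun τ => v * τ) 1 (by fun_prop) (by simp)).and <|
    (key (fun τ => 2 * (ν * τ)) r₁ (by fun_prop) (by simpa)).and <|
    (key (fun τ => τ * lS + ν * τ) r₂ (by fun_prop) (by simpa)).and
    (key (fun τ => ν * τ) r₃ (by fun_prop) (by simpa))
  obtain ⟨ω₁, hω₁⟩ := eventually_atTop.1 hall
  exact ⟨max ω₁ 1, by positivity, fun ω hω => hω₁ ω ((le_max_left _ _).trans hω)⟩

end ExtremumSeeking

end
open ExtremumSeeking in
theorem theorem1 (m : ℕ) (J : State m → ℝ) (hJ : ContDiff ℝ ((⊤ : ℕ∞) : WithTop ℕ∞) J)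
    (a b h : ℝ) (ha : 0 < a) (hb : 0 < b) (hh : 0 < h)
    (ystar y₀ : ℝ) (hy : y₀ < ystar)
    (hcompact : IsCompact {x : State m | y₀ ≤ avgObj J a x})
    (hgrad : ∀ x : State m, y₀ ≤ avgObj J a x → avgObj J a x < ystar →
      gradient (avgObj J a) x ≠ 0)
    (ρ₀ : ℝ) (hρ₀ : 0 < ρ₀) :
    ∃ (β : ℝ → ℝ → ℝ) (γ : ℝ → ℝ) (δ ρ : ℝ),
      ClassKL β ∧ (∀ s, 0 ≤ s → β s 0 = s) ∧ ClassK γ ∧ 0 < δ ∧ 0 < ρ ∧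
      ∀ ε : ℝ, 0 < ε → ∃ (ω₀ : ℝ) (k₀ : ℕ), 0 < ω₀ ∧ 0 < k₀ ∧
        ∀ ω : ℝ, ω₀ ≤ ω → ∀ k : ℕ, k₀ ≤ k → ∀ (t₀ : ℝ) (x₀ : State m),
          y₀ ≤ avgObj J a x₀ → ∀ η₀ : ℝ, |η₀| ≤ ρ₀ →
          ∀ d : MeasureTheory.Lp ℝ ⊤ (MeasureTheory.volume : MeasureTheory.Measure ℝ), ‖d‖ ≤ δ →
            (∃ (I : Set ℝ) (x : ℝ → State m) (η : ℝ → ℝ),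
              IsMaximalSolution J a b h ω k d t₀ x₀ η₀ I x η) ∧
            ∀ (I : Set ℝ) (x : ℝ → State m) (η : ℝ → ℝ),
              IsMaximalSolution J a b h ω k d t₀ x₀ η₀ I x η →
              ∀ t : ℝ, t₀ ≤ t →
                t ∈ I ∧
                ystar - avgObj J a (x t) ≤
                  max (β (max (ystar - avgObj J a x₀) 0) (t - t₀)) (γ ‖d‖) + ε ∧
                |η t| ≤ ρ := by
  set K : Set (State m) := {x | y₀ ≤ avgObj J a x} with hK
  obtain ⟨R₀, hR₀⟩ := hcompact.isBounded.exists_norm_le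
  -- R₀ bounds the superlevel set, 1 is the excursion allowed between sampling times, a is the
  -- dither amplitude, and a further 1 leaves room for strict inequalities.
  obtain ⟨f, M, C, L, hfJ, hf, hC, hL, hM0, hM⟩ := exists_truncation hJ (R₀ + 2 + a)
  have hWJ : ∀ x ∈ K, ∀ z, dist z x ≤ 1 → ‖z‖ + a < R₀ + 2 + a := fun x hx z hz => by
    have h1 := hR₀ x hx
    have h2 : ‖z‖ ≤ ‖z - x‖ + ‖x‖ := by simpa using norm_add_le (z - x) x
    rw [dist_eq_norm] at hz
    linarith
  have hW : ∀ x ∈ K, ∀ z, dist z x ≤ 1 → avgObj f a z = avgObj J a z := fun x hx z hz =>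
    avgObj_congr ha hfJ (hWJ x hx z hz).le
  have hWK : ∀ x ∈ K, avgObj f a x = avgObj J a x := fun x hx => hW x hx x (by simp)
  have hGK : ∀ x ∈ K, gradient (avgObj f a) x = gradient (avgObj J a) x := fun x hx =>
    gradient_avgObj_congr ha hfJ (hWJ x hx x (by simp))
  have hWc : Continuous (avgObj f a) := continuous_iff_continuousAt.2 fun x =>
    (hasFDerivAt_avgObj hf hC a x).continuousAt
  obtain ⟨α, hα0, hα⟩ := exists_orderIso_le (Y := fun x => ystar - avgObj f a x)
    (G := fun x => ‖gradient (avgObj f a) x‖) hcompact (by fun_prop)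
    ((lipschitzWith_gradient_avgObj hf hC hL a).continuous.norm.continuousOn)
    (fun _ _ => norm_nonneg _) (fun x hx hpos => by
      rw [norm_pos_iff, hGK x hx]
      exact hgrad x hx (by rw [← hWK x hx]; linarith))
  set c := avgGain m a
  have hc : 0 < c := avgGain_pos m ha
  have hlm := strictMono_decreaseRate (mul_pos hb hc) α
  have hl0 := decreaseRate_zero (q := b * c) hα0
  obtain ⟨β, hβKL, hβ0, hβ⟩ := exists_classKL_implicit (continuous_decreaseRate (b * c) α) hlm hl0
  have hαs0 : α.symm 0 = 0 := by rw [← hα0, α.symm_apply_apply, hα0]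
  set S₀ := ystar - y₀ with hS₀
  have hS₀pos : 0 < S₀ := sub_pos.2 hy
  -- Chosen so that γ(δ) = S₀/2: the ultimate bound lies well inside the superlevel set.
  set δ := c / 2 * α (S₀ / 2) with hδdef
  have hδ : 0 < δ := by
    have h1 := α.strictMono (half_pos hS₀pos)
    rw [hα0] at h1
    positivity
  -- M + δ bounds the filter input f + d, and ρ₀ the initial filter state.
  set ρ := max ρ₀ (M + δ)
  have hρ : 0 < ρ := lt_max_of_lt_left hρ₀
  obtain ⟨B₁, B₂, hB₁, -, hper⟩ := exists_period_increase hf hC hL hM ha hb hh hρ.le hδ.le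
  have hγmono : StrictMono fun r : ℝ => α.symm (2 * r / c) := fun r s hrs =>
    α.symm.strictMono (by gcongr)
  refine ⟨β, fun r => α.symm (2 * r / c), δ, ρ, hβKL, hβ0, ⟨?_, hγmono.strictMonoOn _, ?_⟩, hδ, hρ,
    fun ε hε => ?_⟩
  · have := α.symm.continuous
    exact Continuous.continuousOn (by fun_prop)
  · simpa using hαs0
  -- The bound ε/2 uses half of the tolerance. The bound S₀/2 gives max γ ε₁ ≤ S₀/2, leaving S₀/2
  -- for the rise during one period.
  set ε₁ := min (ε / 2) (S₀ / 2)
  have hε₁ : 0 < ε₁ := by positivity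
  have hl : 0 < decreaseRate (b * c) α ε₁ := hl0 ▸ hlm hε₁
  obtain ⟨ω₀, hω₀, hω⟩ := exists_period_threshold (B₂ := B₂) (v := b * (M + ρ + δ))
    (ν := C * (b * (M + ρ + δ))) (lS := decreaseRate (b * c) α S₀) (half_pos hl) (half_pos hε) hε
    (half_pos hS₀pos)
  obtain ⟨k₁, hk₁⟩ : ∃ k₁ : ℕ, ∀ k ≥ k₁, B₁ * (1 / 2 : ℝ) ^ k ≤ decreaseRate (b * c) α ε₁ / 2 := by
    have hlim := (tendsto_pow_atTop_nhds_zero_of_lt_one (r := (1 / 2 : ℝ)) (by norm_num)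
      (by norm_num)).const_mul B₁
    rw [mul_zero] at hlim
    exact eventually_atTop.1 (hlim.eventually_le_const (half_pos hl))
  refine ⟨ω₀, max k₁ 1, hω₀, by positivity, fun ω hωω k hk t₀ x₀ hx₀ η₀ hη₀ d hd =>
    ⟨exists_isMaximalSolution J a b h ω k d t₀ x₀ η₀, fun I x η hmax t ht => ?_⟩⟩
  have hk1 : 1 ≤ k := (le_max_right _ _).trans hk
  have hωpos : 0 < ω := hω₀.trans_le hωω
  obtain ⟨c1, c2, c3, c4, c5⟩ := hω ω hωω
  have c6 := hk₁ k ((le_max_left _ _).trans hk)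
  have hdD := ae_abs_le_norm_Lp_top d
  have hdδ : ∀ᵐ s, |d s| ≤ δ := hdD.mono fun s hs => hs.trans hd
  obtain ⟨xs, ηs, hsol, hηs⟩ := exists_isSolution_of_lipschitz (a := a) (ω := ω) (k := k) hC hM hb hh
    (intervalIntegrable_Lp_top d) hdδ (le_max_right ρ₀ (M + δ)) ht x₀ (hη₀.trans (le_max_left _ _))
  have hxs0 : xs t₀ = x₀ := by simpa using hsol.eq_x t₀ ⟨le_rfl, ht⟩
  have hτ : 0 < 2 * Real.pi / ω := div_pos Real.two_pi_pos hωpos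
  have hv : 0 ≤ b * (M + ρ + δ) := by positivity
  have hspeed : ∀ s ∈ Icc t₀ t, ∀ r ∈ Icc t₀ t, s ≤ r →
      ‖xs r - xs s‖ ≤ b * (M + ρ + δ) * (r - s) := fun s hs r hr hsr =>
    hsol.norm_x_sub_le hb.le hM hηs hdδ hs hr hsr
  have hγd : α.symm (2 * ‖d‖ / c) ≤ S₀ / 2 := by
    have h1 : 2 * ‖d‖ / c ≤ α (S₀ / 2) := by
      rw [div_le_iff₀ hc]
      rw [hδdef] at hd
      linarith
    calc _ ≤ α.symm (α (S₀ / 2)) := α.symm.monotone h1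
      _ = _ := α.symm_apply_apply _
  have hest := practical_iss_of_sampled_decrease (W := avgObj f a)
    (G := fun x => ‖gradient (avgObj f a) x‖) (K := K) (ystar := ystar) (S₀ := S₀) (x := xs)
    (t₀ := t₀) (t₁ := t) (τ := 2 * Real.pi / ω) (σ := C * (b * (M + ρ + δ)))
    (v := b * (M + ρ + δ)) (D := ‖d‖) (e := B₁ * (1 / 2) ^ k + B₂ * (2 * Real.pi / ω)) (ε := ε)
    (ε₁ := ε₁) hα0 hb hc
    (fun z hz => by
      have : y₀ ≤ avgObj J a z := hz
      rw [hWK z hz]; linarith)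
    (fun z hz z' hz' hS => by
      rw [hW z hz z' hz'] at hS
      change y₀ ≤ avgObj J a z'
      linarith)
    hα hβ hτ (by positivity) hv (norm_nonneg _) hε₁ (by rw [hxs0]; exact hx₀)
    (fun s hs hs' => hper ω k d t₀ x₀ η₀ _ xs ηs ‖d‖ hωpos hk1 hsol hηs hdD (norm_nonneg _) hd
      s hs hs')
    (fun s hs r hr hsr => by
      refine (abs_avgObj_sub_le hf hC a _ _).trans ?_
      rw [mul_assoc]
      gcongr
      exact hspeed s hs r hr hsr)
    (fun s hs r hr hsr => by rw [dist_eq_norm]; exact hspeed s hs r hr hsr)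
    (by linarith) c2 (by linarith [min_le_left (ε / 2) (S₀ / 2)]) c4
    (by linarith [max_le hγd (min_le_right (ε / 2) (S₀ / 2))])
  -- The estimate keeps the truncated solution within distance 1 of the superlevel set, where f and
  -- J agree at every dithered point.
  have hJsol : IsSolution J a b h ω k d t₀ x₀ η₀ (Icc t₀ t) xs ηs :=
    hsol.congr_objective fun s hs => by
      obtain ⟨z, hz, hdist⟩ := (hest s hs).1
      have h1 := hWJ z hz _ hdist
      refine (hfJ _ ((norm_add_le _ _).trans ?_)).symm
      rw [norm_smul, norm_curveU, mul_one, Real.norm_eq_abs, abs_of_pos ha]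
      exact h1.le
  obtain ⟨hsub, hxeq, hηeq⟩ := hmax.eqOn_forward hJ hb.le hh.le hJsol
  have htt : t ∈ Icc t₀ t := ⟨ht, le_rfl⟩
  refine ⟨hsub htt, ?_, by rw [hηeq htt]; exact hηs t htt⟩
  obtain ⟨⟨z, hz, hdist⟩, hfin⟩ := hest t htt
  rw [hxeq htt, ← hW z hz _ hdist, ← hWK x₀ hx₀]
  rw [hxs0] at hfin
  exact hfin
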